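/- Let $S$ be a finite dimensional complex manifold and let $E, E'\to S$ be holomorphic Hilbert bundles (of finite or infinite rank), endowed with hermitian metrics $h,h'$ of class $C^2$; that is, $h$ and $h'$ are represented in each holomorphic local trivialization, with model fibre a complex Hilbert space $(W,\langle\ ,\ \rangle)$, as $\langle P(s)w_1,w_2\rangle$, where $P$ is a $C^2$ map (for the operator norm) whose values are positive, self adjoint, invertible bounded operators on $W$. Let $\nabla$ be the Chern connection of $h$ (its connection form is $\theta=P^{-1}\partial P$) and, for $\xi\in T^{1,0}_sS$, let $$R(\xi,\bar\xi)=\nabla_\xi\nabla_{\bar\xi}-\nabla_{\bar\xi}\nabla_\xi$$ be its curvature operator on $E_s$, computed after extending $\xi$ to a holomorphic vector field near $s$; let $R'$ be the curvature operator of $h'$, defined in the same way. Let $A:E\to E'$ be a holomorphic homomorphism (a holomorphic map that restricts to a linear map $E_s\to E'_s$ for every $s\in S$), and for $s\in S$ let $$\|A\|(s)=\inf\{a\in[0,\infty): h'(Av,Av)^{1/2}\le a\,h(v,v)^{1/2}\text{ for all }v\in E_s\}$$ denote its pointwise operator norm. Suppose that $A$ decreases curvature: for all $s\in S$, $\xi\in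 T^{1,0}_sS$, and $v\in E_s$ such that $Av\neq0$, $$\frac{h'(R'(\xi,\bar\xi)Av,Av)}{h'(Av,Av)}\le\frac{h(R(\xi,\bar\xi)v,v)}{h(v,v)}.$$ Then $\|A\|$ is finite and $\log\|A\|:S\to[-\infty,\infty)$ is plurisubharmonic: it is upper semicontinuous, and its composition with any holomorphic map from an open subset of $\mathbb C$ to $S$ is subharmonic (the constant $-\infty$ counts as subharmonic). Consequently $\|A\|$ satisfies the maximum principle: if $U\subset S$ is a relatively compact domain with $\partial U\ne\emptyset$, $c\ge0$, and $\|A\|\le c$ on $\partial U$, then $\|A\|\le c$ on $U$. -/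

import Mathlib

open Bundle Set
open scoped Manifold ContDiff ENNReal NNReal

noncomputable section

/-! ### Wirtinger derivatives

`V` is a complex normed space. A vector `ξ : V` stands for the `(1,0)` vector
`(ξ - i J ξ) / 2`, i.e. for `∑ ξ_j ∂/∂z_j`, and the conjugate `(0,1)` vector is
`(ξ + i J ξ) / 2`. -/

section Wirtinger

variable {V : Type*} [NormedAddCommGroup V] [NormedSpace ℂ V]
  {W : Type*} [NormedAddCommGroup W] [NormedSpace ℂ W]

/-- The derivative `ξ f = ∑ ξ_j ∂f/∂z_j` at `z`. -/
def wirtinger (f : V → W) (z ξ : V) : W :=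
  (1 / 2 : ℂ) • (fderiv ℝ f z ξ - Complex.I • fderiv ℝ f z (Complex.I • ξ))

/-- The derivative `ξ̄ f = ∑ conj(ξ_j) ∂f/∂z̄_j` at `z`. -/
def wirtingerBar (f : V → W) (z ξ : V) : W :=
  (1 / 2 : ℂ) • (fderiv ℝ f z ξ + Complex.I • fderiv ℝ f z (Complex.I • ξ))

end Wirtinger

/-! ### The Chern connection of a metric on a trivial bundle

The metric on `V × F` (locally) is `h((z, w₁), (z, w₂)) = ⟨P(z) w₁, w₂⟩`, sections are functions
`f : V → F`. -/

namespace LocalChern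

variable {V : Type*} [NormedAddCommGroup V] [NormedSpace ℂ V]
  {F : Type*} [NormedAddCommGroup F] [InnerProductSpace ℂ F]

/-- The connection form `θ = P⁻¹ ∂P`, of type `(1,0)`, evaluated on the `(1,0)` vector `ξ`. -/
def connectionForm (P : V → F →L[ℂ] F) (z ξ : V) : F →L[ℂ] F :=
  (Ring.inverse (P z)).comp (wirtinger P z ξ)

/-- `∇_ξ f = ξ f + θ(ξ) f`, for the constant `(1,0)` vector field `ξ`. -/
def nabla (P : V → F →L[ℂ] F) (ξ : V) (f : V → F) : V → F :=
  fun z => wirtinger f z ξ + connectionForm P z ξ (f z)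

/-- `∇_ξ̄ f = ξ̄ f` (as `θ` is of type `(1,0)`). -/
def nablaBar (ξ : V) (f : V → F) : V → F :=
  fun z => wirtingerBar f z ξ

/-- The connection is compatible with the metric:
`ξ h(f, g) = h(∇_ξ f, g) + h(f, ∇_ξ̄ g)`. Together with its type this characterizes it. -/
theorem metric_compatible {P : V → F →L[ℂ] F} {z : V} (hP : DifferentiableAt ℝ P z)
    (hu : IsUnit (P z)) {f g : V → F} (hf : DifferentiableAt ℝ f z)
    (hg : DifferentiableAt ℝ g z) (ξ : V) :
    wirtinger (fun x => inner ℂ (g x) (P x (f x))) z ξ =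
      inner ℂ (g z) (P z (nabla P ξ f z)) + inner ℂ (nablaBar ξ g z) (P z (f z)) := by
  have key : ∀ η : V, fderiv ℝ (fun x => inner ℂ (g x) (P x (f x))) z η =
      inner ℂ (g z) (fderiv ℝ P z η (f z) + P z (fderiv ℝ f z η))
        + inner ℂ (fderiv ℝ g z η) (P z (f z)) := by
    intro η
    let B : (F →L[ℂ] F) →L[ℝ] F →L[ℝ] F :=
      ((ContinuousLinearMap.restrictScalarsL ℂ F F ℝ ℝ : (F →L[ℂ] F) →L[ℝ] (F →L[ℝ] F)))
    have h1 : HasFDerivAt (fun x => P x (f x))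
        ((B (P z)).comp (fderiv ℝ f z) + ((B.comp (fderiv ℝ P z)).flip (f z))) z :=
      ((B.hasFDerivAt.comp z hP.hasFDerivAt).clm_apply hf.hasFDerivAt)
    have h2 := fderiv_inner_apply ℂ hg h1.differentiableAt η
    rw [h2, h1.fderiv]
    simp [B, inner_add_right, add_comm]
  have hinv : ∀ x, P z (Ring.inverse (P z) x) = x := fun x => by
    have := Ring.mul_inverse_cancel _ hu
    exact congrArg (fun T : F →L[ℂ] F => T x) this
  simp only [wirtinger, nabla, nablaBar, wirtingerBar, connectionForm, key, map_add,
    ContinuousLinearMap.comp_apply, hinv, _root_.smul_apply,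
    _root_.sub_apply, map_smul, map_sub, inner_add_left, inner_add_right,
    inner_sub_right, inner_smul_left, inner_smul_right, smul_eq_mul, Complex.conj_I, map_div₀,
    map_one, map_ofNat]
  ring

/-- The curvature operator `R(ξ, ξ̄) = ∇_ξ ∇_ξ̄ - ∇_ξ̄ ∇_ξ` at `z`, applied to `w`; here `ξ` is
extended to a constant vector field and `w` to a constant section. -/
def curvature (P : V → F →L[ℂ] F) (z ξ : V) (w : F) : F :=
  nabla P ξ (nablaBar ξ fun _ => w) z - nablaBar ξ (nabla P ξ fun _ => w) z

end LocalChern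

/-! ### Hermitian metrics on holomorphic Hilbert bundles -/

section Metric

variable (V : Type*) [NormedAddCommGroup V] [NormedSpace ℂ V]
  {S : Type*} [TopologicalSpace S] [ChartedSpace V S]
  (F : Type*) [NormedAddCommGroup F] [InnerProductSpace ℂ F]
  (E : S → Type*) [∀ s, AddCommGroup (E s)] [∀ s, Module ℂ (E s)]
  [∀ s, TopologicalSpace (E s)] [TopologicalSpace (TotalSpace F E)] [FiberBundle F E]

/-- A hermitian metric of class `C²` on the bundle `E` with model fibre the Hilbert space `F`:
in each local trivialization it has the form `h(w₁, w₂) = ⟨P(s) w₁, w₂⟩`, where `P` is `C²` in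
the real sense, for the operator norm, and has positive invertible values. (Mathlib's `inner` is
linear in its second argument, `h` in its first.) -/
structure HermitianMetric where
  /-- the value `h(v, w)` for `v, w` in the fibre over `s` -/
  form : ∀ s, E s → E s → ℂ
  exists_gram : ∀ (e : Trivialization F (π F E)) [MemTrivializationAtlas e],
    ∃ P : S → F →L[ℂ] F,
      ContMDiffOn 𝓘(ℝ, V) 𝓘(ℝ, F →L[ℂ] F) 2 P e.baseSet ∧
      ∀ s ∈ e.baseSet, (P s).IsPositive ∧ IsUnit (P s) ∧
        ∀ w₁ w₂ : F, form s (e.symm s w₁) (e.symm s w₂) = inner ℂ w₂ (P s w₁)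

variable {V F E}

namespace HermitianMetric

/-- The norm `h(v, v)^{1/2}` on the fibre over `s`. -/
def norm (h : HermitianMetric V F E) (s : S) (v : E s) : ℝ :=
  Real.sqrt (h.form s v v).re

/-- The operator valued function `P` representing `h` over the base of a trivialization
(where it is uniquely determined by `h`). -/
def gram (h : HermitianMetric V F E) (e : Trivialization F (π F E))
    [MemTrivializationAtlas e] : S → F →L[ℂ] F :=
  Classical.choose (h.exists_gram e)

/-- The operator `P` of `h` in the preferred trivialization at `s`, expressed in the preferred
holomorphic chart at `s`. -/
def localGram (h : HermitianMetric V F E) (s : S) : V → F →L[ℂ] F :=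
  fun z => h.gram (trivializationAt F E s) ((chartAt V s).symm z)

/-- The curvature operator `R(ξ, ξ̄) : E_s → E_s` of the Chern connection of `h`, computed in the
preferred holomorphic chart and trivialization at `s` (the result does not depend on them). A
tangent vector `ξ` stands for the `(1,0)` vector `(ξ - i J ξ) / 2`. -/
def curvature (h : HermitianMetric V F E) (s : S) (ξ : TangentSpace 𝓘(ℂ, V) s) (v : E s) : E s :=
  (trivializationAt F E s).symm s
    (LocalChern.curvature (h.localGram s) (chartAt V s s) ξ (trivializationAt F E s ⟨s, v⟩).2)

end HermitianMetric

variable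
  {F' : Type*} [NormedAddCommGroup F'] [InnerProductSpace ℂ F']
  {E' : S → Type*} [∀ s, AddCommGroup (E' s)] [∀ s, Module ℂ (E' s)]
  [∀ s, TopologicalSpace (E' s)] [TopologicalSpace (TotalSpace F' E')] [FiberBundle F' E']

/-- The operator norm `inf {a ∈ [0, ∞) : h'(Av, Av)^{1/2} ≤ a h(v, v)^{1/2} for all v ∈ E_s}` of
a homomorphism at the point `s` (`∞` if there is no such `a`). -/
def pointwiseNorm (h : HermitianMetric V F E) (h' : HermitianMetric V F' E')
    (A : ∀ s, E s →L[ℂ] E' s) (s : S) : ℝ≥0∞ :=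
  ⨅ (a : ℝ≥0) (_ : ∀ v : E s, h'.norm s (A s v) ≤ a * h.norm s v), (a : ℝ≥0∞)

/-- `A` decreases curvature. (The numbers `h(R(ξ, ξ̄)v, v)` are real.) -/
def DecreasesCurvature (h : HermitianMetric V F E) (h' : HermitianMetric V F' E')
    (A : ∀ s, E s →L[ℂ] E' s) : Prop :=
  ∀ (s : S) (ξ : TangentSpace 𝓘(ℂ, V) s) (v : E s), A s v ≠ 0 →
    (h'.form s (h'.curvature s ξ (A s v)) (A s v)).re / (h'.form s (A s v) (A s v)).re ≤
      (h.form s (h.curvature s ξ v) v).re / (h.form s v v).re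

end Metric

/-! ### Plurisubharmonic functions -/

/-- Subharmonic functions on an open set `D ⊆ ℂ`, with values in `[-∞, ∞)`: upper semicontinuous
and below every harmonic majorant, i.e. if `K ⊆ D` is compact and `g` is continuous on `K`,
harmonic in the interior of `K`, and `u ≤ g` on the boundary of `K`, then `u ≤ g` on `K`. The
function that is identically `-∞` is allowed. -/
def SubharmonicOn (u : ℂ → EReal) (D : Set ℂ) : Prop :=
  UpperSemicontinuousOn u D ∧ (∀ z ∈ D, u z < ⊤) ∧
    ∀ K ⊆ D, IsCompact K → ∀ g : ℂ → ℝ, ContinuousOn g K →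
      InnerProductSpace.HarmonicOnNhd g (interior K) →
      (∀ z ∈ frontier K, u z ≤ (g z : EReal)) → ∀ z ∈ K, u z ≤ (g z : EReal)

/-- Plurisubharmonic functions on a complex manifold, with values in `[-∞, ∞)`: upper
semicontinuous, and subharmonic along every holomorphic map from an open subset of `ℂ`. -/
def Plurisubharmonic (V : Type*) [NormedAddCommGroup V] [NormedSpace ℂ V]
    {S : Type*} [TopologicalSpace S] [ChartedSpace V S] (u : S → EReal) : Prop :=
  UpperSemicontinuous u ∧ (∀ s, u s < ⊤) ∧
    ∀ (D : Set ℂ) (f : ℂ → S), IsOpen D → ContMDiffOn 𝓘(ℂ, ℂ) 𝓘(ℂ, V) ω f D →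
      SubharmonicOn (fun z => u (f z)) D

/-- The maximum principle for `p : S → [0, ∞]`: on a relatively compact domain `U` with nonempty
boundary, `p` is bounded by any bound of `p` on the boundary. -/
def SatisfiesMaximumPrinciple {S : Type*} [TopologicalSpace S] (p : S → ℝ≥0∞) : Prop :=
  ∀ U : Set S, IsOpen U → IsConnected U → IsCompact (closure U) → (frontier U).Nonempty →
    ∀ c : ℝ≥0∞, (∀ s ∈ frontier U, p s ≤ c) → ∀ s ∈ U, p s ≤ c

end

/-! The argument is a maximum principle at second order. Suppose that along a holomorphic curve `f`
the function `log ‖A‖` exceeds a harmonic majorant `g` on a compact set `K`. For small `ε > 0`,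
upper semicontinuity gives a point of `K` where `log ‖A‖ - g + ε|z|²` is maximal, and the boundary
inequality forces this point `z₀` into the interior. Near `z₀` write `g = Re G`, and write `|z|²` as
`|z - z₀|²` plus the real part of a holomorphic function. The pluriharmonic terms are absorbed into
`A` by a nowhere zero holomorphic factor, which does not affect the curvature quotients. The new
homomorphism `a` has square norm at most `c (1 - ε|z - z₀|²)`, with equality at `z₀`.

`LocalChern.not_strict_max_of_curvature_le` excludes this. Extend a unit vector `v` to a holomorphic
section `Tv` with `∇(Tv) = 0` at `z₀`. Then `∂̄∂ h(Tv, Tv) = -h(Rv, v)`, while `∂̄∂ h'(aTv, aTv) ≥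
-h'(R'av, av)`, because the term `h'(∇', ∇')` is nonnegative. If `n'` is the square norm of `av`,
the curvature hypothesis makes the second quantity at least `n'` times the first, so the quotient of
the two square norms cannot drop by `ε|z - z₀|²` to second order.

In infinite rank the operator norm need not be attained at any `v`. Therefore `v` is only nearly
extremal, with a defect of order `t²`, and the expansions at the four points `z₀ ± t`, `z₀ ± it`
must be uniform in `v`. They are, since they are made for the operators `T* P T` in the operator
norm (`ContDiffAt.four_points_isLittleO`); `t` is fixed first and `v` afterwards.

The maximum principle then follows from plurisubharmonicity, by the strong maximum principle on
discs (`SubharmonicOn.eq_of_isMax_center`) and connectedness. -/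

noncomputable section

open Filter Topology Asymptotics InnerProductSpace

/-! ### Positive operators and pulled back forms -/

section Operators

variable {F : Type*} [NormedAddCommGroup F] [InnerProductSpace ℂ F]
  {F' : Type*} [NormedAddCommGroup F'] [InnerProductSpace ℂ F']

/-- A positive invertible operator is bounded below. -/
theorem ContinuousLinearMap.IsPositive.exists_le_re_inner_of_isUnit {P : F →L[ℂ] F}
    (hP : P.IsPositive) (hu : IsUnit P) :
    ∃ κ : ℝ, 0 < κ ∧ ∀ w, κ * ‖w‖ ^ 2 ≤ (inner ℂ w (P w)).re := by
  obtain ⟨u, rfl⟩ := hu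
  set P : F →L[ℂ] F := ↑u with hPdef
  set Q : F →L[ℂ] F := ↑(u⁻¹) with hQ
  have hQP : ∀ w, Q (P w) = w := fun w =>
    congrArg (fun T : F →L[ℂ] F => T w) u.inv_mul
  set t : ℝ := 1 / (‖P‖ + 1) with ht
  have hn : (0 : ℝ) ≤ ‖P‖ := norm_nonneg _
  have ht0 : 0 < t := by positivity
  have ht1 : t * ‖P‖ ≤ 1 := by
    rw [ht, div_mul_eq_mul_div, div_le_one (by positivity)]; linarith
  refine ⟨t / (‖Q‖ + 1) ^ 2, by positivity, fun w => ?_⟩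
  have h1 : ‖w‖ ≤ (‖Q‖ + 1) * ‖P w‖ := by
    calc ‖w‖ = ‖Q (P w)‖ := by rw [hQP]
      _ ≤ ‖Q‖ * ‖P w‖ := Q.le_opNorm _
      _ ≤ _ := by gcongr; linarith
  have h2 : t * ‖P w‖ ^ 2 ≤ (inner ℂ w (P w)).re := by
    -- Positivity at `w - tPw`, with `t‖P‖ ≤ 1`, gives `t‖Pw‖² ≤ ⟨w, Pw⟩` without a square root of
    -- `P`.
    have h3 := hP.re_inner_nonneg_right (w - (t : ℂ) • P w)
    have h4 : (inner ℂ (P w) (P (P w))).re ≤ ‖P‖ * ‖P w‖ ^ 2 := by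
      calc _ ≤ ‖inner ℂ (P w) (P (P w))‖ := Complex.re_le_norm _
        _ ≤ ‖P w‖ * ‖P (P w)‖ := norm_inner_le_norm _ _
        _ ≤ ‖P w‖ * (‖P‖ * ‖P w‖) := by gcongr; exact P.le_opNorm _
        _ = _ := by ring
    have h5 : (inner ℂ w (P (P w)) : ℂ) = inner ℂ (P w) (P w) := (hP.1 _ _).symm
    have h6 : (inner ℂ (P w) (P w) : ℂ).re = ‖P w‖ ^ 2 := by
      rw [inner_self_eq_norm_sq_to_K]; norm_cast
    simp only [map_sub, map_smul, inner_sub_left, inner_sub_right, inner_smul_left,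
      inner_smul_right, h5, Complex.conj_ofReal, RCLike.re_to_complex, Complex.sub_re,
      Complex.re_ofReal_mul, h6] at h3
    nlinarith [mul_le_mul_of_nonneg_left h4 (mul_pos ht0 ht0).le,
      mul_le_mul_of_nonneg_right ht1 (mul_nonneg ht0.le (sq_nonneg ‖P w‖))]
  calc t / (‖Q‖ + 1) ^ 2 * ‖w‖ ^ 2 ≤ t / (‖Q‖ + 1) ^ 2 * ((‖Q‖ + 1) * ‖P w‖) ^ 2 := by gcongr
    _ = t * ‖P w‖ ^ 2 := by field_simp
    _ ≤ _ := h2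

variable [CompleteSpace F] [CompleteSpace F']

/-- The adjoint, as a real linear map. -/
def adjointRealCLM (F F' : Type*) [NormedAddCommGroup F] [InnerProductSpace ℂ F] [CompleteSpace F]
    [NormedAddCommGroup F'] [InnerProductSpace ℂ F'] [CompleteSpace F'] :
    (F →L[ℂ] F') →L[ℝ] (F' →L[ℂ] F) :=
  AddMonoidHom.toRealLinearMap
    (ContinuousLinearMap.adjoint (𝕜 := ℂ) (E := F) (F := F')).toLinearEquiv.toAddEquiv.toAddMonoidHom
    (ContinuousLinearMap.adjoint (𝕜 := ℂ) (E := F) (F := F')).continuous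

theorem adjointRealCLM_apply (T : F →L[ℂ] F') :
    adjointRealCLM F F' T = ContinuousLinearMap.adjoint T := rfl

/-- The operator `T* P T` that represents the pull back of the form of `P`. -/
def pullbackForm (P : F' →L[ℂ] F') (T : F →L[ℂ] F') : F →L[ℂ] F :=
  (adjointRealCLM F F' T).comp (P.comp T)

theorem inner_pullbackForm (P : F' →L[ℂ] F') (T : F →L[ℂ] F') (v w : F) :
    inner ℂ v (pullbackForm P T w) = inner ℂ (T v) (P (T w)) := by
  simp [pullbackForm, adjointRealCLM_apply, ContinuousLinearMap.adjoint_inner_right]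

theorem ContDiffAt.comp_complexCLM {V X Y Z : Type*} [NormedAddCommGroup V] [NormedSpace ℝ V]
    [NormedAddCommGroup X] [NormedSpace ℂ X] [NormedAddCommGroup Y] [NormedSpace ℂ Y]
    [NormedAddCommGroup Z] [NormedSpace ℂ Z] {n : ℕ∞ω} {A : V → Y →L[ℂ] Z} {B : V → X →L[ℂ] Y}
    {x : V} (hA : ContDiffAt ℝ n A x) (hB : ContDiffAt ℝ n B x) :
    ContDiffAt ℝ n (fun y => (A y).comp (B y)) x :=
  ContDiffAt.comp (g := fun p : (Y →L[ℂ] Z) × (X →L[ℂ] Y) => p.1.comp p.2) x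
    ((ContinuousLinearMap.compL ℂ X Y Z).bilinearRestrictScalars
      ℝ).isBoundedBilinearMap.contDiff.contDiffAt (hA.prodMk hB)

theorem ContDiffAt.pullbackForm {V : Type*} [NormedAddCommGroup V] [NormedSpace ℝ V]
    {n : ℕ∞ω} {P : V → F' →L[ℂ] F'} {T : V → F →L[ℂ] F'} {x : V}
    (hP : ContDiffAt ℝ n P x) (hT : ContDiffAt ℝ n T x) :
    ContDiffAt ℝ n (fun y => pullbackForm (P y) (T y)) x :=
  ((adjointRealCLM F F').contDiff.contDiffAt.comp x hT).comp_complexCLM (hP.comp_complexCLM hT)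

end Operators

/-! ### Rules for Wirtinger derivatives -/

section WirtingerCalculus

variable {V : Type*} [NormedAddCommGroup V] [NormedSpace ℂ V]
  {W : Type*} [NormedAddCommGroup W] [NormedSpace ℂ W]

theorem Filter.EventuallyEq.wirtingerBar_eq {f g : V → W} {z : V} (h : f =ᶠ[𝓝 z] g) (ξ : V) :
    wirtingerBar f z ξ = wirtingerBar g z ξ := by
  simp only [wirtingerBar, h.fderiv_eq]

theorem wirtingerBar_eq_zero {f : V → W} {z : V} (hf : DifferentiableAt ℂ f z) (ξ : V) :
    wirtingerBar f z ξ = 0 := by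
  simp [wirtingerBar, hf.fderiv_restrictScalars ℝ, smul_smul]

theorem wirtinger_eq_fderiv {f : V → W} {z : V} (hf : DifferentiableAt ℂ f z) (ξ : V) :
    wirtinger f z ξ = fderiv ℂ f z ξ := by
  simp only [wirtinger, hf.fderiv_restrictScalars ℝ, ContinuousLinearMap.coe_restrictScalars',
    map_smul, smul_smul, Complex.I_mul_I]
  module

theorem wirtingerBar_star {f : V → ℂ} {z : V} (ξ : V) :
    wirtingerBar (fun x => star (f x)) z ξ = star (wirtinger f z ξ) := by
  simp only [wirtingerBar, wirtinger, fderiv_star]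
  simp

theorem wirtinger_clm {X : Type*} [NormedAddCommGroup X] [NormedSpace ℂ X] (L : W →L[ℂ] X)
    {f : V → W} {z : V} (hf : DifferentiableAt ℝ f z) (ξ : V) :
    wirtinger (fun x => L (f x)) z ξ = L (wirtinger f z ξ) := by
  have : fderiv ℝ (fun x => L (f x)) z = (L.restrictScalars ℝ).comp (fderiv ℝ f z) :=
    ((L.restrictScalars ℝ).hasFDerivAt.comp z hf.hasFDerivAt).fderiv
  simp [wirtinger, this]

theorem wirtingerBar_clm {X : Type*} [NormedAddCommGroup X] [NormedSpace ℂ X] (L : W →L[ℂ] X)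
    {f : V → W} {z : V} (hf : DifferentiableAt ℝ f z) (ξ : V) :
    wirtingerBar (fun x => L (f x)) z ξ = L (wirtingerBar f z ξ) := by
  have : fderiv ℝ (fun x => L (f x)) z = (L.restrictScalars ℝ).comp (fderiv ℝ f z) :=
    ((L.restrictScalars ℝ).hasFDerivAt.comp z hf.hasFDerivAt).fderiv
  simp [wirtingerBar, this]

theorem wirtingerBar_add {f g : V → W} {z : V} (hf : DifferentiableAt ℝ f z)
    (hg : DifferentiableAt ℝ g z) (ξ : V) :
    wirtingerBar (fun x => f x + g x) z ξ = wirtingerBar f z ξ + wirtingerBar g z ξ := by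
  simp only [wirtingerBar, fderiv_fun_add hf hg, _root_.add_apply]
  module

theorem wirtingerBar_clm_apply {X : Type*} [NormedAddCommGroup X] [NormedSpace ℂ X]
    {T : V → W →L[ℂ] X} {f : V → W} {z : V} (hT : DifferentiableAt ℝ T z)
    (hf : DifferentiableAt ℝ f z) (ξ : V) :
    wirtingerBar (fun x => T x (f x)) z ξ =
      wirtingerBar T z ξ (f z) + T z (wirtingerBar f z ξ) := by
  let B : (W →L[ℂ] X) →L[ℝ] W →L[ℝ] X := ContinuousLinearMap.restrictScalarsL ℂ W X ℝ ℝ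
  have h1 : HasFDerivAt (fun x => T x (f x))
      ((B (T z)).comp (fderiv ℝ f z) + ((B.comp (fderiv ℝ T z)).flip (f z))) z :=
    (B.hasFDerivAt.comp z hT.hasFDerivAt).clm_apply hf.hasFDerivAt
  simp only [wirtingerBar, h1.fderiv]
  simp [B]
  module

theorem ContDiffAt.eventually_differentiableAt {𝕜 E G : Type*} [RCLike 𝕜]
    [NormedAddCommGroup E] [NormedSpace 𝕜 E] [NormedAddCommGroup G] [NormedSpace 𝕜 G]
    {f : E → G} {x : E} (hf : ContDiffAt 𝕜 2 f x) : ∀ᶠ y in 𝓝 x, DifferentiableAt 𝕜 f y := by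
  filter_upwards [hf.eventually (by simp)] with y hy using hy.differentiableAt (by simp)

theorem ContDiffAt.differentiableAt_fderiv {𝕜 E G : Type*} [RCLike 𝕜]
    [NormedAddCommGroup E] [NormedSpace 𝕜 E] [NormedAddCommGroup G] [NormedSpace 𝕜 G]
    {f : E → G} {x : E} (hf : ContDiffAt 𝕜 2 f x) : DifferentiableAt 𝕜 (fderiv 𝕜 f) x :=
  (hf.fderiv_right (m := 1) (by norm_num)).differentiableAt (by simp)

theorem ContDiffAt.differentiableAt_wirtinger {f : V → W} {z : V} (hf : ContDiffAt ℝ 2 f z)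
    (ξ : V) : DifferentiableAt ℝ (fun x => wirtinger f x ξ) z := by
  have := hf.differentiableAt_fderiv
  unfold wirtinger
  fun_prop

end WirtingerCalculus

/-! ### Curvature of the local Chern connection and the `∂̄∂` formula -/

namespace LocalChern

variable {V : Type*} [NormedAddCommGroup V] [NormedSpace ℂ V]
  {F : Type*} [NormedAddCommGroup F] [InnerProductSpace ℂ F]

/-- This is the conjugate of `metric_compatible`. Symmetry of `P` is needed near `z`, not only at
`z`, because the function is replaced by its conjugate before differentiating. -/
theorem metric_compatible_bar {P : V → F →L[ℂ] F} {z : V} (hP : DifferentiableAt ℝ P z)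
    (hu : IsUnit (P z)) (hs : ∀ᶠ x in 𝓝 z, (P x).IsSymmetric) {f g : V → F}
    (hf : DifferentiableAt ℝ f z) (hg : DifferentiableAt ℝ g z) (ξ : V) :
    wirtingerBar (fun x => inner ℂ (g x) (P x (f x))) z ξ =
      inner ℂ (nabla P ξ g z) (P z (f z)) + inner ℂ (g z) (P z (nablaBar ξ f z)) := by
  have h1 : (fun x => inner ℂ (g x) (P x (f x))) =ᶠ[𝓝 z]
      fun x => star (inner ℂ (f x) (P x (g x)) : ℂ) := by
    filter_upwards [hs] with x hx
    rw [show (star (inner ℂ (f x) (P x (g x)) : ℂ)) = inner ℂ (P x (g x)) (f x) from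
      inner_conj_symm _ _]
    exact (hx _ _).symm
  have hz := hs.self_of_nhds
  have hc : ∀ a b : F, star (inner ℂ a (P z b) : ℂ) = inner ℂ b (P z a) := fun a b =>
    (inner_conj_symm _ _).trans (hz _ _)
  rw [h1.wirtingerBar_eq, wirtingerBar_star, metric_compatible hP hu hg hf, star_add, hc, hc]

variable [CompleteSpace F]

theorem differentiableAt_connectionForm {P : V → F →L[ℂ] F} {z : V} (hP : ContDiffAt ℝ 2 P z)
    (hu : IsUnit (P z)) (ξ : V) : DifferentiableAt ℝ (fun x => connectionForm P x ξ) z := by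
  have h1 : DifferentiableAt ℝ (fun x => Ring.inverse (P x)) z :=
    (differentiableAt_inverse (𝕜 := ℝ) hu).comp z (hP.differentiableAt (by simp))
  exact h1.mul (hP.differentiableAt_wirtinger ξ)

/-- A constant section is killed by `∂̄`, and its `∇` is `θ(ξ)w`; so `R = -∂̄θ`, which also shows
that `R` is a bounded linear operator in `w`. -/
theorem curvature_eq {P : V → F →L[ℂ] F} {z ξ : V}
    (h : DifferentiableAt ℝ (fun x => connectionForm P x ξ) z) (w : F) :
    curvature P z ξ w = -(wirtingerBar (fun x => connectionForm P x ξ) z ξ w) := by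
  have h0 : nablaBar ξ (fun _ : V => w) = fun _ => 0 := by
    ext x; simp [nablaBar, wirtingerBar]
  have h1 : nabla P ξ (fun _ : V => w) = fun x => connectionForm P x ξ w := by
    ext x; simp [nabla, wirtinger]
  rw [curvature, h0, h1]
  have h2 := wirtingerBar_clm_apply h (differentiableAt_const (𝕜 := ℝ) (x := z) w) ξ
  simp only [nablaBar, h2]
  simp [nabla, wirtinger, wirtingerBar]

/-- Both `f` and `∂f` are holomorphic, so in `∂f + θf` only `θ` contributes to `∂̄`. -/
theorem dbar_nabla {P : V → F →L[ℂ] F} {z ξ : V} (hP : ContDiffAt ℝ 2 P z)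
    (hu : IsUnit (P z)) {f : V → F} (hf : ContDiffAt ℂ 2 f z) :
    DifferentiableAt ℝ (nabla P ξ f) z ∧
    nablaBar ξ (nabla P ξ f) z = -curvature P z ξ (f z) := by
  have hθ := differentiableAt_connectionForm hP hu ξ
  have hfC := hf.differentiableAt (by simp)
  have hfR : DifferentiableAt ℝ f z := hfC.restrictScalars ℝ
  have e1 : nabla P ξ f =ᶠ[𝓝 z] fun x => fderiv ℂ f x ξ + connectionForm P x ξ (f x) := by
    filter_upwards [hf.eventually_differentiableAt] with x hx
    simp only [nabla, wirtinger_eq_fderiv hx]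
  have d1 : DifferentiableAt ℂ (fun x => fderiv ℂ f x ξ) z :=
    hf.differentiableAt_fderiv.clm_apply (differentiableAt_const ξ)
  have d2 : DifferentiableAt ℝ (fun x => connectionForm P x ξ (f x)) z :=
    ((ContinuousLinearMap.restrictScalarsL ℂ F F ℝ ℝ).differentiableAt.comp z hθ).clm_apply hfR
  have d1' : DifferentiableAt ℝ (fun x => fderiv ℂ f x ξ) z := d1.restrictScalars ℝ
  refine ⟨(d1'.add d2).congr_of_eventuallyEq e1, ?_⟩
  rw [nablaBar, e1.wirtingerBar_eq, wirtingerBar_add d1' d2, wirtingerBar_eq_zero d1,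
    wirtingerBar_clm_apply hθ hfR, wirtingerBar_eq_zero hfC, curvature_eq hθ]
  simp

/-- For a holomorphic section `f`, `∂̄∂ h(f, f) = -h(R f, f) + h(∇f, ∇f)`. -/
theorem dbar_d_inner {P : V → F →L[ℂ] F} {z ξ : V} (hP : ContDiffAt ℝ 2 P z)
    (hu : ∀ᶠ x in 𝓝 z, IsUnit (P x)) (hs : ∀ᶠ x in 𝓝 z, (P x).IsSymmetric) {f : V → F}
    (hf : ContDiffAt ℂ 2 f z) :
    wirtingerBar (fun x => wirtinger (fun y => inner ℂ (f y) (P y (f y))) x ξ) z ξ =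
      inner ℂ (nabla P ξ f z) (P z (nabla P ξ f z))
        - inner ℂ (f z) (P z (curvature P z ξ (f z))) := by
  have e1 : (fun x => wirtinger (fun y => inner ℂ (f y) (P y (f y))) x ξ) =ᶠ[𝓝 z]
      fun x => inner ℂ (f x) (P x (nabla P ξ f x)) := by
    filter_upwards [hf.eventually_differentiableAt, hP.eventually_differentiableAt, hu]
      with x hx hPx hux
    rw [metric_compatible hPx hux (hx.restrictScalars ℝ) (hx.restrictScalars ℝ)]
    simp [nablaBar, wirtingerBar_eq_zero hx]
  obtain ⟨d, e⟩ := dbar_nabla (ξ := ξ) hP hu.self_of_nhds hf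
  rw [e1.wirtingerBar_eq, metric_compatible_bar (hP.differentiableAt (by simp)) hu.self_of_nhds hs
    d ((hf.differentiableAt (by simp)).restrictScalars ℝ), e]
  simp [sub_eq_add_neg]

theorem curvature_smul {P : V → F →L[ℂ] F} {z ξ : V} (hP : ContDiffAt ℝ 2 P z)
    (hu : IsUnit (P z)) (a : ℂ) (w : F) :
    curvature P z ξ (a • w) = a • curvature P z ξ w := by
  have := differentiableAt_connectionForm hP hu ξ
  rw [curvature_eq this, curvature_eq this, map_smul, smul_neg]

end LocalChern

/-! ### Complex linear parts and composition with holomorphic curves -/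

section HolomorphicPart

variable {V : Type*} [NormedAddCommGroup V] [NormedSpace ℂ V]
  {W : Type*} [NormedAddCommGroup W] [NormedSpace ℂ W]

/-- The complex linear part `ξ ↦ (D ξ - i D (i ξ)) / 2` of a real linear map `D`. -/
def ContinuousLinearMap.complexPart (D : V →L[ℝ] W) : V →L[ℂ] W :=
  LinearMap.mkContinuous
    { toFun := fun ξ => (1 / 2 : ℂ) • (D ξ - Complex.I • D (Complex.I • ξ))
      map_add' := fun x y => by simp only [smul_add, map_add]; module
      map_smul' := fun c x => by
        have h : ∀ y : V, D (c • y) = (c.re : ℂ) • D y + (c.im : ℂ) • D (Complex.I • y) := by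
          intro y
          have : c • y = c.re • y + c.im • (Complex.I • y) := by
            conv_lhs => rw [← Complex.re_add_im c, add_smul, mul_smul]
            simp
          rw [this, map_add, map_smul, map_smul]
          simp
        have h2 : Complex.I • c • x = c • Complex.I • x := smul_comm _ _ _
        rw [h2, h, h]
        simp only [smul_smul, Complex.I_mul_I, RingHom.id_apply, neg_smul, one_smul, map_neg]
        conv_rhs => rw [← Complex.re_add_im c]
        match_scalars <;> ring_nf <;> simp <;> ring }
    ‖D‖ fun ξ => by
      have h1 := D.le_opNorm ξ
      have h2 := D.le_opNorm (Complex.I • ξ)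
      have h3 := norm_sub_le (D ξ) (Complex.I • D (Complex.I • ξ))
      simp only [norm_smul, Complex.norm_I, one_mul] at h2 h3
      simp only [LinearMap.coe_mk, AddHom.coe_mk, norm_smul]
      norm_num
      linarith

theorem ContinuousLinearMap.complexPart_apply (D : V →L[ℝ] W) (ξ : V) :
    D.complexPart ξ = (1 / 2 : ℂ) • (D ξ - Complex.I • D (Complex.I • ξ)) := rfl

theorem ContinuousLinearMap.norm_complexPart_le (D : V →L[ℝ] W) : ‖D.complexPart‖ ≤ ‖D‖ :=
  LinearMap.mkContinuous_norm_le _ (norm_nonneg _) _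

/-- `ContinuousLinearMap.complexPart` as a real linear map. -/
def complexLinearPart (V W : Type*) [NormedAddCommGroup V] [NormedSpace ℂ V]
    [NormedAddCommGroup W] [NormedSpace ℂ W] : (V →L[ℝ] W) →L[ℝ] (V →L[ℂ] W) :=
  LinearMap.mkContinuous
    { toFun := ContinuousLinearMap.complexPart
      map_add' := fun D D' => by
        ext ξ
        simp only [ContinuousLinearMap.complexPart_apply, _root_.add_apply]
        module
      map_smul' := fun c D => by
        ext ξ
        simp only [ContinuousLinearMap.complexPart_apply, _root_.smul_apply, RingHom.id_apply,
          smul_comm _ c, ← smul_sub] }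
    1 fun D => by simpa using D.norm_complexPart_le

theorem wirtinger_comp {f : V → W} {γ : ℂ → V} {z : ℂ} (hf : DifferentiableAt ℝ f (γ z))
    (hγ : DifferentiableAt ℂ γ z) :
    wirtinger (fun ζ => f (γ ζ)) z 1 = wirtinger f (γ z) (deriv γ z) := by
  have h : HasFDerivAt (fun ζ => f (γ ζ)) ((fderiv ℝ f (γ z)).comp
      ((fderiv ℂ γ z).restrictScalars ℝ)) z :=
    hf.hasFDerivAt.comp z (hγ.hasFDerivAt.restrictScalars ℝ)
  simp [wirtinger, h.fderiv]

theorem wirtingerBar_comp {f : V → W} {γ : ℂ → V} {z : ℂ} (hf : DifferentiableAt ℝ f (γ z))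
    (hγ : DifferentiableAt ℂ γ z) :
    wirtingerBar (fun ζ => f (γ ζ)) z 1 = wirtingerBar f (γ z) (deriv γ z) := by
  have h : HasFDerivAt (fun ζ => f (γ ζ)) ((fderiv ℝ f (γ z)).comp
      ((fderiv ℂ γ z).restrictScalars ℝ)) z :=
    hf.hasFDerivAt.comp z (hγ.hasFDerivAt.restrictScalars ℝ)
  simp [wirtingerBar, h.fderiv]

end HolomorphicPart

/-! ### Naturality of the curvature under pull back -/

namespace LocalChern

variable {V : Type*} [NormedAddCommGroup V] [NormedSpace ℂ V]
  {F : Type*} [NormedAddCommGroup F] [InnerProductSpace ℂ F] [CompleteSpace F]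

/-- The curvature of the pull back of a metric along a holomorphic curve. -/
theorem curvature_comp {P : V → F →L[ℂ] F} {γ : ℂ → V} {z : ℂ} (hP : ContDiffAt ℝ 2 P (γ z))
    (hu : IsUnit (P (γ z))) (hγ : ContDiffAt ℂ 2 γ z) (w : F) :
    curvature (fun ζ => P (γ ζ)) z 1 w = curvature P (γ z) (deriv γ z) w := by
  have hγ1 := hγ.differentiableAt (by simp)
  have hγc : ContinuousAt γ z := hγ.continuousAt
  have hPγ : ContDiffAt ℝ 2 (fun ζ => P (γ ζ)) z :=
    hP.comp z (hγ.restrict_scalars ℝ)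
  rw [curvature_eq (differentiableAt_connectionForm hPγ hu 1),
    curvature_eq (differentiableAt_connectionForm hP hu _)]
  -- The direction `γ'(ζ)` varies with `ζ`, so `θ` is treated as a map into operators in `ξ`, not
  -- for one fixed `ξ`.
  let K : V → V →L[ℂ] (F →L[ℂ] F) := fun x =>
    (ContinuousLinearMap.mul ℂ (F →L[ℂ] F) (Ring.inverse (P x))).comp
      (complexLinearPart V (F →L[ℂ] F) (fderiv ℝ P x))
  have hK : ∀ x ξ, K x ξ = connectionForm P x ξ := fun x ξ => rfl
  have dinv : DifferentiableAt ℝ (fun x => Ring.inverse (P x)) (γ z) :=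
    (differentiableAt_inverse (𝕜 := ℝ) hu).comp _ (hP.differentiableAt (by simp))
  have dK : DifferentiableAt ℝ K (γ z) := by
    have b := ((ContinuousLinearMap.compL ℂ V (F →L[ℂ] F) (F →L[ℂ] F)).bilinearRestrictScalars
      ℝ).isBoundedBilinearMap
    refine DifferentiableAt.comp (g := fun p : ((F →L[ℂ] F) →L[ℂ] (F →L[ℂ] F)) ×
      (V →L[ℂ] (F →L[ℂ] F)) => p.1.comp p.2)
      (f := fun x => (ContinuousLinearMap.mul ℂ (F →L[ℂ] F) (Ring.inverse (P x)),
        complexLinearPart V (F →L[ℂ] F) (fderiv ℝ P x))) (γ z) (b.differentiableAt _) ?_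
    refine DifferentiableAt.prodMk ?_ ?_
    · exact (((ContinuousLinearMap.mul ℂ (F →L[ℂ] F)).restrictScalars ℝ).differentiableAt).comp _
        dinv
    · exact (complexLinearPart V (F →L[ℂ] F)).differentiableAt.comp _ hP.differentiableAt_fderiv
  have e1 : (fun ζ => connectionForm (fun ζ => P (γ ζ)) ζ 1) =ᶠ[𝓝 z]
      fun ζ => K (γ ζ) (deriv γ ζ) := by
    filter_upwards [hγ.eventually_differentiableAt,
      hγc.eventually hP.eventually_differentiableAt] with ζ h1 h2
    rw [hK, connectionForm, connectionForm, wirtinger_comp h2 h1]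
  have dγ' : DifferentiableAt ℂ (deriv γ) z :=
    hγ.differentiableAt_fderiv.clm_apply (differentiableAt_const (1 : ℂ))
  have dKγ : DifferentiableAt ℝ (fun ζ => K (γ ζ)) z :=
    dK.comp z (hγ1.restrictScalars ℝ)
  have h2 : wirtingerBar (fun x => connectionForm P x (deriv γ z)) (γ z) (deriv γ z) =
      wirtingerBar K (γ z) (deriv γ z) (deriv γ z) :=
    wirtingerBar_clm (ContinuousLinearMap.apply ℂ (F →L[ℂ] F) (deriv γ z)) dK _
  -- Since `γ'` is holomorphic, `∂̄` falls on `K ∘ γ` only.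
  rw [e1.wirtingerBar_eq, wirtingerBar_clm_apply dKγ (dγ'.restrictScalars ℝ),
    wirtingerBar_eq_zero dγ', wirtingerBar_comp dK hγ1, h2]
  simp

end LocalChern

/-! ### Second order expansions with values in a normed space -/

section FourPoints

variable {X : Type*} [NormedAddCommGroup X]

/-- The second symmetric difference of a `C²` map. -/
theorem ContDiffAt.add_sub_isLittleO [NormedSpace ℝ X] {V : Type*} [NormedAddCommGroup V]
    [NormedSpace ℝ V] {H : V → X} {z : V} (hH : ContDiffAt ℝ 2 H z) (ξ : V) :
    (fun t : ℝ => H (z + t • ξ) + H (z - t • ξ) - (2 : ℝ) • H z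
      - t ^ 2 • fderiv ℝ (fderiv ℝ H) z ξ ξ) =o[𝓝 0] fun t : ℝ => t ^ 2 := by
  set D := fderiv ℝ H
  set X2 := fderiv ℝ D z ξ ξ
  have hd : HasFDerivAt D (fderiv ℝ D z) z := hH.differentiableAt_fderiv.hasFDerivAt
  have hline : HasDerivAt (fun t : ℝ => z + t • ξ) ξ 0 := by
    simpa using ((hasDerivAt_id (0 : ℝ)).smul_const ξ).const_add z
  have hline' : HasDerivAt (fun t : ℝ => z - t • ξ) (-ξ) 0 := by
    simpa using ((hasDerivAt_id (0 : ℝ)).smul_const ξ).const_sub z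
  -- The `t`-derivative of the remainder is `o(t)` by differentiability of `D` at the single point
  -- `z`; the mean value inequality then makes the remainder `o(t²)`.
  have hr : HasDerivAt (fun t : ℝ => D (z + t • ξ) ξ - D (z - t • ξ) ξ - (2 * t) • X2) 0 0 := by
    have h1 : HasDerivAt (fun t : ℝ => D (z + t • ξ)) (fderiv ℝ D z ξ) 0 := by
      have hd0 : HasFDerivAt D (fderiv ℝ D z) (z + (0 : ℝ) • ξ) := by simpa using hd
      exact (hd0.comp_hasDerivAt (0 : ℝ) hline).congr_deriv (by simp)
    have h2 : HasDerivAt (fun t : ℝ => D (z - t • ξ)) (-fderiv ℝ D z ξ) 0 := by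
      have hd0 : HasFDerivAt D (fderiv ℝ D z) (z - (0 : ℝ) • ξ) := by simpa using hd
      exact (hd0.comp_hasDerivAt (0 : ℝ) hline').congr_deriv (by simp)
    have h3 : HasDerivAt (fun t : ℝ => (2 * t) • X2) ((2 : ℝ) • X2) 0 := by
      simpa using ((hasDerivAt_id (0 : ℝ)).const_mul 2).smul_const X2
    have := ((h1.clm_apply (hasDerivAt_const _ ξ)).sub (h2.clm_apply (hasDerivAt_const _ ξ))).sub h3
    refine this.congr_deriv ?_
    simp [X2, two_smul]
  have hr' : (fun t : ℝ => D (z + t • ξ) ξ - D (z - t • ξ) ξ - (2 * t) • X2) =o[𝓝 0]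
      fun t : ℝ => t := by
    simpa using hr.isLittleO
  have hev : ∀ᶠ t : ℝ in 𝓝 0, DifferentiableAt ℝ H (z + t • ξ) ∧
      DifferentiableAt ℝ H (z - t • ξ) := by
    have e := hH.eventually_differentiableAt
    have c1 : Tendsto (fun t : ℝ => z + t • ξ) (𝓝 0) (𝓝 z) := by
      simpa using hline.continuousAt.tendsto
    have c2 : Tendsto (fun t : ℝ => z - t • ξ) (𝓝 0) (𝓝 z) := by
      simpa using hline'.continuousAt.tendsto
    exact (c1.eventually e).and (c2.eventually e)
  rw [isLittleO_iff] at hr' ⊢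
  intro c hc
  obtain ⟨ρ, hρ, hball⟩ := Metric.eventually_nhds_iff_ball.1 ((hr' hc).and hev)
  refine Metric.eventually_nhds_iff_ball.2 ⟨ρ, hρ, fun t ht => ?_⟩
  have hsub : ∀ s ∈ Metric.closedBall (0 : ℝ) |t|, s ∈ Metric.ball (0 : ℝ) ρ := by
    intro s hs
    simp only [Metric.mem_closedBall, Metric.mem_ball, dist_zero_right, Real.norm_eq_abs] at *
    exact hs.trans_lt ht
  have hder : ∀ s ∈ Metric.closedBall (0 : ℝ) |t|,
      HasDerivWithinAt (fun t : ℝ => H (z + t • ξ) + H (z - t • ξ) - (2 : ℝ) • H z - t ^ 2 • X2)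
        (D (z + s • ξ) ξ - D (z - s • ξ) ξ - (2 * s) • X2) (Metric.closedBall (0 : ℝ) |t|) s := by
    intro s hs
    obtain ⟨-, g1, g2⟩ := hball s (hsub s hs)
    have l1 : HasDerivAt (fun t : ℝ => z + t • ξ) ξ s := by
      simpa using ((hasDerivAt_id s).smul_const ξ).const_add z
    have l2 : HasDerivAt (fun t : ℝ => z - t • ξ) (-ξ) s := by
      simpa using ((hasDerivAt_id s).smul_const ξ).const_sub z
    have l3 : HasDerivAt (fun t : ℝ => t ^ 2 • X2) ((2 * s) • X2) s := by
      simpa using (hasDerivAt_pow 2 s).smul_const X2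
    have := (((g1.hasFDerivAt.comp_hasDerivAt s l1).add
      (g2.hasFDerivAt.comp_hasDerivAt s l2)).sub_const ((2 : ℝ) • H z)).sub l3
    refine (this.congr_deriv ?_).hasDerivWithinAt
    simp [D, sub_eq_add_neg]
  have hbd : ∀ s ∈ Metric.closedBall (0 : ℝ) |t|,
      ‖D (z + s • ξ) ξ - D (z - s • ξ) ξ - (2 * s) • X2‖ ≤ c * |t| := by
    intro s hs
    refine (hball s (hsub s hs)).1.trans ?_
    simp only [Metric.mem_closedBall, dist_zero_right] at hs
    gcongr
  have := (convex_closedBall (0 : ℝ) |t|).norm_image_sub_le_of_norm_hasDerivWithin_le hder hbd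
    (Metric.mem_closedBall_self (abs_nonneg t)) (y := t) (by simp)
  have e0 : H (z + (0 : ℝ) • ξ) + H (z - (0 : ℝ) • ξ) - (2 : ℝ) • H z - (0 : ℝ) ^ 2 • X2 = 0 := by
    simp [two_smul]
  rw [e0, sub_zero] at this
  refine this.trans (le_of_eq ?_)
  simp only [sub_zero, Real.norm_eq_abs, abs_pow]
  ring

/-- The sum of a `C²` map over the four points `z ± t`, `z ± it`. -/
theorem ContDiffAt.four_points_isLittleO [NormedSpace ℂ X] {H : ℂ → X} {z : ℂ}
    (hH : ContDiffAt ℝ 2 H z) :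
    (fun t : ℝ => H (z + t) + H (z - t) + H (z + t * Complex.I) + H (z - t * Complex.I)
      - (4 : ℝ) • H z - (4 * t ^ 2) • wirtingerBar (fun x => wirtinger H x 1) z 1)
      =o[𝓝 0] fun t : ℝ => t ^ 2 := by
  have h := (hH.add_sub_isLittleO (1 : ℂ)).add (hH.add_sub_isLittleO Complex.I)
  refine h.congr_left fun t => ?_
  -- Symmetry cancels the mixed terms, so `4∂̄∂` is the sum of the pure second derivatives along `1`
  -- and `i`.
  have hsymm : fderiv ℝ (fderiv ℝ H) z 1 Complex.I = fderiv ℝ (fderiv ℝ H) z Complex.I 1 :=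
    (hH.isSymmSndFDerivAt (by simp)) 1 Complex.I
  have hd := hH.differentiableAt_fderiv
  have h1 : ∀ η ξ : ℂ, fderiv ℝ (fun x => fderiv ℝ H x ξ) z η =
      fderiv ℝ (fderiv ℝ H) z η ξ := by
    intro η ξ
    rw [fderiv_clm_apply hd (by fun_prop)]
    simp
  have h2 : ∀ η : ℂ, fderiv ℝ (fun x => wirtinger H x 1) z η = (1 / 2 : ℂ) •
      (fderiv ℝ (fderiv ℝ H) z η 1 - Complex.I • fderiv ℝ (fderiv ℝ H) z η Complex.I) := by
    intro η
    have d1 : DifferentiableAt ℝ (fun x => fderiv ℝ H x (1 : ℂ)) z := by fun_prop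
    have d2 : DifferentiableAt ℝ (fun x => fderiv ℝ H x Complex.I) z := by fun_prop
    simp only [wirtinger, smul_eq_mul, mul_one]
    rw [fderiv_fun_const_smul (d1.fun_sub (d2.fun_const_smul Complex.I)),
      fderiv_fun_sub d1 (d2.fun_const_smul Complex.I), fderiv_fun_const_smul d2]
    simp [h1]
  simp only [wirtingerBar, h2, hsymm, smul_eq_mul, mul_one, Complex.real_smul]
  have e : ∀ (r : ℝ) (x : X), r • x = (r : ℂ) • x := fun r x => (Complex.coe_smul r x).symm
  simp only [e]
  match_scalars <;> simp <;> ring_nf <;> simp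

end FourPoints

/-! ### Decreasing curvature excludes a strict maximum of order two -/

namespace LocalChern

variable {F : Type*} [NormedAddCommGroup F] [InnerProductSpace ℂ F] [CompleteSpace F]
  {F' : Type*} [NormedAddCommGroup F'] [InnerProductSpace ℂ F'] [CompleteSpace F']

/-- Pairing with `v` is a continuous linear functional of the operator, so it commutes with both
derivatives and `dbar_d_inner` applies to the section `Tv`. -/
theorem inner_dbar_d_pullbackForm {P : ℂ → F' →L[ℂ] F'} {T : ℂ → F →L[ℂ] F'} {z : ℂ}
    (hP : ContDiffAt ℝ 2 P z) (hpos : ∀ᶠ x in 𝓝 z, (P x).IsPositive ∧ IsUnit (P x))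
    (hT : ContDiffAt ℂ 2 T z) (v : F) :
    inner ℂ v (wirtingerBar (fun x => wirtinger (fun y => pullbackForm (P y) (T y)) x 1) z 1 v) =
      inner ℂ (nabla P 1 (fun x => T x v) z) (P z (nabla P 1 (fun x => T x v) z))
        - inner ℂ (T z v) (P z (curvature P z 1 (T z v))) := by
  have hH : ContDiffAt ℝ 2 (fun y => pullbackForm (P y) (T y)) z :=
    hP.pullbackForm (hT.restrict_scalars ℝ)
  let ℓ : (F →L[ℂ] F) →L[ℂ] ℂ := (innerSL ℂ v).comp (ContinuousLinearMap.apply ℂ F v)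
  have hℓ : ∀ S, ℓ S = inner ℂ v (S v) := fun S => rfl
  have e1 : (fun x => ℓ (wirtinger (fun y => pullbackForm (P y) (T y)) x 1)) =ᶠ[𝓝 z]
      fun x => wirtinger (fun y => inner ℂ (T y v) (P y (T y v))) x 1 := by
    filter_upwards [hH.eventually_differentiableAt] with x hx
    rw [← wirtinger_clm ℓ hx]
    simp only [hℓ, inner_pullbackForm]
  rw [← hℓ, ← wirtingerBar_clm ℓ (hH.differentiableAt_wirtinger 1), e1.wirtingerBar_eq]
  exact dbar_d_inner hP (hpos.mono fun _ h => h.2) (hpos.mono fun _ h => h.1.1)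
    (hT.clm_apply contDiffAt_const)

/-- Here `τ = t²`. The gain `4cετ` has to beat the losses, which are at most `cετ/2` from `c - n`,
`cετ/8` from `(c - n)l`, `cετ` from `β`, and `cετ` from the product of `ετ` and `τl`. -/
theorem four_point_arithmetic {c ε τ C n l l' β : ℝ} (hc : 0 < c) (hε : 0 < ε) (hτ : 0 < τ)
    (h1 : τ * (4 * C) < 1) (hn : c - c * ε * τ / 8 ≤ n) (hnc : n ≤ c)
    (hl : |l| ≤ C) (hl' : n * l ≤ l') (hβ : (1 + c) * β = c * ε * τ) (hβ0 : 0 ≤ β)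
    (h : 4 * n + 4 * τ * l' - β ≤ c * (1 - ε * τ) * (4 + 4 * τ * l + β)) : False := by
  obtain ⟨l1, l2⟩ := abs_le.1 hl
  have h0 : 0 < c * ε * τ := by positivity
  have hC : 0 ≤ C := (abs_nonneg l).trans hl
  have q4 : (c - n) * l * τ ≤ c * ε * τ / 32 := by
    calc (c - n) * l * τ ≤ (c - n) * C * τ := by gcongr
      _ ≤ (c * ε * τ / 8) * C * τ := by gcongr; linarith
      _ = (c * ε * τ / 32) * (τ * (4 * C)) := by ring
      _ ≤ (c * ε * τ / 32) * 1 := by gcongr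
      _ = _ := mul_one _
  have q5 : τ * (n * l) ≤ τ * l' := by gcongr
  have q6 : -(c * ε * τ * (τ * l)) ≤ c * ε * τ / 4 := by
    have : τ * (-l) ≤ τ * C := by gcongr; linarith
    calc -(c * ε * τ * (τ * l)) = c * ε * τ * (τ * (-l)) := by ring
      _ ≤ c * ε * τ * (1 / 4) := by gcongr; linarith
      _ = _ := by ring
  have q7 : 0 ≤ c * (ε * τ) * β := by positivity
  linarith

/-- A holomorphic homomorphism that decreases curvature at `z₀` cannot have a square norm with
a strict maximum of order two at `z₀`. -/
theorem not_strict_max_of_curvature_le {P : ℂ → F →L[ℂ] F} {P' : ℂ → F' →L[ℂ] F'}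
    {a : ℂ → F →L[ℂ] F'} {z₀ : ℂ} (hP : ContDiffAt ℝ 2 P z₀) (hP' : ContDiffAt ℝ 2 P' z₀)
    (ha : ContDiffAt ℂ 2 a z₀) (hpos : ∀ᶠ z in 𝓝 z₀, (P z).IsPositive ∧ IsUnit (P z))
    (hpos' : ∀ᶠ z in 𝓝 z₀, (P' z).IsPositive ∧ IsUnit (P' z)) {c ε : ℝ} (hc : 0 < c)
    (hε : 0 < ε)
    (hle : ∀ᶠ z in 𝓝 z₀, ∀ v, (inner ℂ (a z v) (P' z (a z v))).re ≤
      c * (1 - ε * ‖z - z₀‖ ^ 2) * (inner ℂ v (P z v)).re)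
    (hsup : ∀ δ > 0, ∃ v, (inner ℂ v (P z₀ v)).re = 1 ∧
      c - δ ≤ (inner ℂ (a z₀ v) (P' z₀ (a z₀ v))).re)
    (hcurv : ∀ v, a z₀ v ≠ 0 →
      (inner ℂ (a z₀ v) (P' z₀ (curvature P' z₀ 1 (a z₀ v)))).re /
          (inner ℂ (a z₀ v) (P' z₀ (a z₀ v))).re ≤
        (inner ℂ v (P z₀ (curvature P z₀ 1 v))).re / (inner ℂ v (P z₀ v)).re) : False := by
  obtain ⟨hp0, hu0⟩ := hpos.self_of_nhds
  obtain ⟨hp0', -⟩ := hpos'.self_of_nhds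
  obtain ⟨κ, hκ, hcoer⟩ := hp0.exists_le_re_inner_of_isUnit hu0
  -- With this `L` the holomorphic section `v + (z - z₀)Lv` has `∇ = 0` at `z₀`.
  set L : F →L[ℂ] F := -connectionForm P z₀ 1 with hL
  set T : ℂ → F →L[ℂ] F := fun z => ContinuousLinearMap.id ℂ F + (z - z₀) • L with hTdef
  have hT : ContDiffAt ℂ 2 T z₀ := by
    simp only [hTdef]
    fun_prop
  have hT0 : T z₀ = ContinuousLinearMap.id ℂ F := by simp [hTdef]
  have haT : ContDiffAt ℂ 2 (fun z => (a z).comp (T z)) z₀ := ha.clm_comp hT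
  set H : ℂ → F →L[ℂ] F := fun z => pullbackForm (P z) (T z) with hH
  set H' : ℂ → F →L[ℂ] F := fun z => pullbackForm (P' z) ((a z).comp (T z)) with hH'
  have cH : ContDiffAt ℝ 2 H z₀ := hP.pullbackForm (hT.restrict_scalars ℝ)
  have cH' : ContDiffAt ℝ 2 H' z₀ := hP'.pullbackForm (haT.restrict_scalars ℝ)
  have hnabla : ∀ v, nabla P 1 (fun x => T x v) z₀ = 0 := by
    intro v
    have hd : HasDerivAt (fun x => T x v) (L v) z₀ := by
      have : HasDerivAt (fun x : ℂ => v + (x - z₀) • L v) (L v) z₀ := by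
        simpa using (((hasDerivAt_id z₀).sub_const z₀).smul_const (L v)).const_add v
      simpa [hTdef] using this
    rw [nabla, wirtinger_eq_fderiv hd.differentiableAt]
    simp only [fderiv_eq_smul_deriv, hd.deriv, hT0]
    simp [hL]
  set Λ := wirtingerBar (fun x => wirtinger H x 1) z₀ 1 with hΛ
  set Λ' := wirtingerBar (fun x => wirtinger H' x 1) z₀ 1 with hΛ'
  have eΛ : ∀ v, (inner ℂ v (Λ v)).re = -(inner ℂ v (P z₀ (curvature P z₀ 1 v))).re := by
    intro v
    rw [hΛ, hH, inner_dbar_d_pullbackForm hP hpos hT v, hnabla, hT0]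
    simp
  have eΛ' : ∀ v, -(inner ℂ (a z₀ v) (P' z₀ (curvature P' z₀ 1 (a z₀ v)))).re ≤
      (inner ℂ v (Λ' v)).re := by
    intro v
    rw [hΛ', hH', inner_dbar_d_pullbackForm hP' hpos' haT v, hT0]
    have := hp0'.re_inner_nonneg_right (nabla P' 1 (fun x => ((a x).comp (T x)) v) z₀)
    simp only [RCLike.re_to_complex] at this
    simp only [Complex.sub_re, ContinuousLinearMap.comp_id]
    linarith
  -- the four point sums
  have hbound : ∀ (S : F →L[ℂ] F) (v : F), |(inner ℂ v (S v)).re| ≤ ‖S‖ * ‖v‖ ^ 2 := by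
    intro S v
    calc |(inner ℂ v (S v)).re| ≤ ‖inner ℂ v (S v)‖ := Complex.abs_re_le_norm _
      _ ≤ ‖v‖ * ‖S v‖ := norm_inner_le_norm _ _
      _ ≤ ‖v‖ * (‖S‖ * ‖v‖) := by gcongr; exact S.le_opNorm v
      _ = _ := by ring
  -- Since `‖v‖² ≤ 1/κ`, an error `μt²` in operator norm costs at most `β = cεt²/(1 + c)` at `v`,
  -- that is `(1 + c)β = cεt²` for the two expansions together.
  set μ : ℝ := c * ε * κ / (1 + c) with hμ
  have hμ0 : 0 < μ := by positivity
  have ev := ((cH.four_points_isLittleO).bound hμ0).and ((cH'.four_points_isLittleO).bound hμ0)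
  have ht0 : Tendsto (fun t : ℝ => (t : ℂ)) (𝓝 0) (𝓝 0) := by
    simpa using (Complex.continuous_ofReal.tendsto 0)
  have hq : ∀ ξ : ℂ, Tendsto (fun t : ℝ => z₀ + t * ξ) (𝓝 0) (𝓝 z₀) := by
    intro ξ
    simpa using (ht0.mul_const ξ).const_add z₀
  set C1 : ℝ := ‖Λ‖ / κ with hC1
  have hC10 : 0 ≤ C1 := by positivity
  have evsmall : ∀ᶠ t : ℝ in 𝓝 0, t ^ 2 * (4 * C1) < 1 ∧ ε * t ^ 2 < 1 := by
    have h1 : Tendsto (fun t : ℝ => t ^ 2 * (4 * C1)) (𝓝 0) (𝓝 0) := by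
      have : Continuous (fun t : ℝ => t ^ 2 * (4 * C1)) := by fun_prop
      simpa using this.tendsto 0
    have h2 : Tendsto (fun t : ℝ => ε * t ^ 2) (𝓝 0) (𝓝 0) := by
      have : Continuous (fun t : ℝ => ε * t ^ 2) := by fun_prop
      simpa using this.tendsto 0
    exact (h1.eventually_lt_const one_pos).and (h2.eventually_lt_const one_pos)
  have evle := (((hq 1).eventually hle).and ((hq (-1)).eventually hle)).and
    (((hq Complex.I).eventually hle).and ((hq (-Complex.I)).eventually hle))
  obtain ⟨t, ⟨⟨⟨hr, hr'⟩, hs1, hs2⟩, ⟨hl1, hl2⟩, hl3, hl4⟩, htpos⟩ :=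
    ((((ev.and evsmall).and evle).filter_mono nhdsWithin_le_nhds).and
      (self_mem_nhdsWithin (s := Ioi (0 : ℝ)))).exists
  replace htpos : 0 < t := htpos
  set δ : ℝ := c * ε * t ^ 2 / 8 with hδ
  have hδ0 : 0 < δ := by positivity
  -- `v` is chosen after `t`, with defect at most `δ`, of order `t²`; the bound `c/2` ensures `a z₀
  -- v ≠ 0`.
  obtain ⟨v, hv1, hv2⟩ := hsup (min δ (c / 2)) (by positivity)
  have hvδ : c - δ ≤ (inner ℂ (a z₀ v) (P' z₀ (a z₀ v))).re := by
    have := min_le_left δ (c / 2); linarith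
  have hvpos : 0 < (inner ℂ (a z₀ v) (P' z₀ (a z₀ v))).re := by
    have := min_le_right δ (c / 2); linarith
  have hav : a z₀ v ≠ 0 := by
    intro h0; simp [h0] at hvpos
  have hvn : ‖v‖ ^ 2 ≤ 1 / κ := by
    rw [le_div_iff₀ hκ]; have := hcoer v; linarith
  set n' := (inner ℂ (a z₀ v) (P' z₀ (a z₀ v))).re with hn'
  have hn'c : n' ≤ c := by
    have := hle.self_of_nhds v
    simpa [hv1] using this
  set lam := (inner ℂ v (Λ v)).re with hlam
  set lam' := (inner ℂ v (Λ' v)).re with hlam'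
  have hlamle : |lam| ≤ C1 := by
    calc |lam| ≤ ‖Λ‖ * ‖v‖ ^ 2 := hbound _ _
      _ ≤ ‖Λ‖ * (1 / κ) := by gcongr
      _ = C1 := by rw [hC1]; ring
  have hlam2 : n' * lam ≤ lam' := by
    have h1 := hcurv v hav
    rw [hv1, div_one, div_le_iff₀ hvpos] at h1
    have h2 := eΛ' v
    have h3 := eΛ v
    rw [hlam, h3]
    nlinarith
  have key : ∀ ξ : ℂ, ‖ξ‖ = 1 → (∀ w, (inner ℂ (a (z₀ + t * ξ) w)
      (P' (z₀ + t * ξ) (a (z₀ + t * ξ) w))).re ≤ c * (1 - ε * ‖z₀ + t * ξ - z₀‖ ^ 2) *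
        (inner ℂ w (P (z₀ + t * ξ) w)).re) →
      (inner ℂ v (H' (z₀ + t * ξ) v)).re ≤
        c * (1 - ε * t ^ 2) * (inner ℂ v (H (z₀ + t * ξ) v)).re := by
    intro ξ hξ h
    have h1 := h (T (z₀ + t * ξ) v)
    simp only [add_sub_cancel_left, norm_mul, hξ, mul_one, Complex.norm_real, Real.norm_eq_abs,
      sq_abs] at h1
    simp only [hH, hH', inner_pullbackForm]
    exact h1
  have k1 := key 1 (by simp) hl1
  have k2 := key (-1) (by simp) hl2
  have k3 := key Complex.I (by simp) hl3
  have k4 := key (-Complex.I) (by simp) hl4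
  simp only [mul_one, mul_neg, ← sub_eq_add_neg] at k1 k2 k3 k4
  have hH0 : (inner ℂ v (H z₀ v)).re = 1 := by
    simp only [hH, inner_pullbackForm, hT0]; exact hv1
  have hH0' : (inner ℂ v (H' z₀ v)).re = n' := by
    simp only [hH', inner_pullbackForm, hT0]; rfl
  have hre : ∀ (r : ℝ) (x y : F), (inner ℂ x (r • y)).re = r * (inner ℂ x y).re := by
    intro r x y
    rw [show r • y = (r : ℂ) • y from (Complex.coe_smul r y).symm, inner_smul_right,
      Complex.re_ofReal_mul]
  have b1 := (hbound _ v).trans (mul_le_mul_of_nonneg_right hr (sq_nonneg ‖v‖))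
  have b2 := (hbound _ v).trans (mul_le_mul_of_nonneg_right hr' (sq_nonneg ‖v‖))
  simp only [_root_.sub_apply, _root_.add_apply, _root_.smul_apply, inner_sub_right,
    inner_add_right, Complex.sub_re, Complex.add_re, hre, hH0, hH0', Real.norm_eq_abs,
    abs_of_pos (pow_pos htpos 2)] at b1 b2
  have hb : μ * t ^ 2 * ‖v‖ ^ 2 ≤ c * ε * t ^ 2 / (1 + c) := by
    calc μ * t ^ 2 * ‖v‖ ^ 2 ≤ μ * t ^ 2 * (1 / κ) := by gcongr
      _ = _ := by rw [hμ]; field_simp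
  set β := c * ε * t ^ 2 / (1 + c) with hβ
  have hβc : (1 + c) * β = c * ε * t ^ 2 := by rw [hβ]; field_simp
  have hβ0 : 0 ≤ β := by positivity
  have b1' := (abs_le.1 (b1.trans hb)).2
  have b2' := (abs_le.1 (b2.trans hb)).1
  rw [← hlam] at b1'
  rw [← hlam'] at b2'
  set σ := (inner ℂ v (H (z₀ + t) v)).re + (inner ℂ v (H (z₀ - t) v)).re +
    (inner ℂ v (H (z₀ + t * Complex.I) v)).re + (inner ℂ v (H (z₀ - t * Complex.I) v)).re with hσ
  have q1 : 4 * n' + 4 * t ^ 2 * lam' - β ≤ c * (1 - ε * t ^ 2) * σ := by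
    rw [hσ]; linarith
  have q2 : σ ≤ 4 + 4 * t ^ 2 * lam + β := by
    rw [hσ]; linarith
  have q3 : c * (1 - ε * t ^ 2) * σ ≤ c * (1 - ε * t ^ 2) * (4 + 4 * t ^ 2 * lam + β) := by
    have := mul_nonneg hc.le (sub_nonneg.2 hs2.le)
    gcongr
  exact four_point_arithmetic hc hε (by positivity) hs1 hvδ hn'c hlamle hlam2 hβc hβ0
    (q1.trans q3)

end LocalChern

/-! ### Local representatives of `A`, of the metrics and of the pointwise norm -/

section LocalModel

variable {V : Type*} [NormedAddCommGroup V] [NormedSpace ℂ V]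
  {S : Type*} [TopologicalSpace S] [ChartedSpace V S]
  {F : Type*} [NormedAddCommGroup F] [InnerProductSpace ℂ F]
  {E : S → Type*} [∀ s, AddCommGroup (E s)] [∀ s, Module ℂ (E s)]
  [∀ s, TopologicalSpace (E s)] [TopologicalSpace (TotalSpace F E)] [FiberBundle F E]
  {F' : Type*} [NormedAddCommGroup F'] [InnerProductSpace ℂ F']
  {E' : S → Type*} [∀ s, AddCommGroup (E' s)] [∀ s, Module ℂ (E' s)]
  [∀ s, TopologicalSpace (E' s)] [TopologicalSpace (TotalSpace F' E')] [FiberBundle F' E']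

/-- A holomorphic homomorphism is represented, in the preferred chart and trivializations, by a
holomorphic operator valued function. -/
theorem exists_contDiffAt_representative [IsManifold 𝓘(ℂ, V) ω S]
    [VectorBundle ℂ F E] [ContMDiffVectorBundle ω F E 𝓘(ℂ, V)]
    [VectorBundle ℂ F' E'] [ContMDiffVectorBundle ω F' E' 𝓘(ℂ, V)]
    {A : ∀ s, E s →L[ℂ] E' s}
    (hA : ContMDiff (𝓘(ℂ, V).prod 𝓘(ℂ, F)) (𝓘(ℂ, V).prod 𝓘(ℂ, F')) ω
      (fun x : TotalSpace F E => (⟨x.1, A x.1 x.2⟩ : TotalSpace F' E'))) (s₀ : S) :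
    ∃ b : V → F →L[ℂ] F', ContDiffAt ℂ 2 b (chartAt V s₀ s₀) ∧ ∀ᶠ s in 𝓝 s₀, ∀ w,
      A s ((trivializationAt F E s₀).symm s w) =
        (trivializationAt F' E' s₀).symm s (b (chartAt V s₀ s) w) := by
  set e := trivializationAt F E s₀ with he
  set e' := trivializationAt F' E' s₀ with he'
  set φ := chartAt V s₀ with hφ
  have hs : s₀ ∈ φ.source := mem_chart_source V s₀
  have hb : s₀ ∈ e.baseSet := FiberBundle.mem_baseSet_trivializationAt' s₀
  have hb' : s₀ ∈ e'.baseSet := FiberBundle.mem_baseSet_trivializationAt' s₀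
  have hy : φ s₀ ∈ φ.target := φ.map_source hs
  have hinv : φ.symm (φ s₀) = s₀ := φ.left_inv hs
  let k : V × F → S × F := fun p => (φ.symm p.1, p.2)
  let g : V × F → TotalSpace F' E' := fun p =>
    (fun x : TotalSpace F E => (⟨x.1, A x.1 x.2⟩ : TotalSpace F' E'))
      (e.toOpenPartialHomeomorph.symm (k p))
  let G : V × F → F' := fun p => (e' (g p)).2
  have hg : ∀ y s, φ.symm y = s → s ∈ e.baseSet → ∀ w,
      g (y, w) = ⟨s, A s (e.symm s w)⟩ := by
    rintro y s rfl h1 w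
    simp only [g, k]
    rw [← e.mk_symm h1 w]
  have hk : ContMDiffAt (𝓘(ℂ, V).prod 𝓘(ℂ, F)) (𝓘(ℂ, V).prod 𝓘(ℂ, F)) ω k (φ s₀, 0) := by
    have h1 : ContMDiffAt 𝓘(ℂ, V) 𝓘(ℂ, V) ω φ.symm (φ s₀) :=
      contMDiffOn_chart_symm.contMDiffAt (φ.open_target.mem_nhds hy)
    exact (ContMDiffAt.comp (φ s₀, (0 : F)) (g := φ.symm) (f := Prod.fst) h1
      contMDiffAt_fst).prodMk contMDiffAt_snd
  have hsymm : ContMDiffAt (𝓘(ℂ, V).prod 𝓘(ℂ, F)) (𝓘(ℂ, V).prod 𝓘(ℂ, F)) ω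
      e.toOpenPartialHomeomorph.symm (k (φ s₀, 0)) := by
    refine e.contMDiffOn_symm.contMDiffAt (e.open_target.mem_nhds ?_)
    rw [e.mem_target]
    simpa [k, hinv] using hb
  have hgC : ContMDiffAt (𝓘(ℂ, V).prod 𝓘(ℂ, F)) (𝓘(ℂ, V).prod 𝓘(ℂ, F')) ω g (φ s₀, 0) :=
    hA.contMDiffAt.comp _ (hsymm.comp _ hk)
  have hGm : ContMDiffAt (𝓘(ℂ, V).prod 𝓘(ℂ, F)) 𝓘(ℂ, F') ω G (φ s₀, 0) := by
    refine ((e'.contMDiffAt_iff ?_).1 hgC).2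
    rw [hg _ _ hinv hb, e'.mem_source]
    exact hb'
  have hG : ContDiffAt ℂ ω G (φ s₀, 0) := by
    rw [← modelWithCornersSelf_prod, chartedSpaceSelf_prod] at hGm
    exact hGm.contDiffAt
  -- The fibre derivative of the jointly holomorphic `G` along the zero section is holomorphic in
  -- operator norm. As `G` is linear on fibres, this derivative is the fibre map itself.
  refine ⟨fun y => (fderiv ℂ G (y, 0)).comp (ContinuousLinearMap.inr ℂ V F), ?_, ?_⟩
  · have h1 : ContDiffAt ℂ 2 (fderiv ℂ G) (φ s₀, 0) := hG.fderiv_right (by simp)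
    have h2 : ContDiffAt ℂ 2 (fun y => fderiv ℂ G (y, 0)) (φ s₀) :=
      ContDiffAt.comp (φ s₀) (f := fun y : V => (y, (0 : F))) h1 (by fun_prop)
    exact h2.clm_comp contDiffAt_const
  · have hd : ∀ᶠ y in 𝓝 (φ s₀), DifferentiableAt ℂ G (y, 0) := by
      have h1 := (hG.of_le (m := 2) (by simp)).eventually_differentiableAt
      have h2 : Tendsto (fun y : V => (y, (0 : F))) (𝓝 (φ s₀)) (𝓝 (φ s₀, 0)) :=
        (Continuous.tendsto (by fun_prop) _)
      exact h2.eventually h1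
    filter_upwards [(φ.continuousAt hs).eventually hd, φ.open_source.mem_nhds hs,
      e.open_baseSet.mem_nhds hb, e'.open_baseSet.mem_nhds hb'] with s h1 h2 h3 h4 w
    have hl : φ.symm (φ s) = s := φ.left_inv h2
    let N : F →L[ℂ] F' := (e'.continuousLinearMapAt ℂ s).comp ((A s).comp (e.symmL ℂ s))
    have hN : ∀ u, G (φ s, u) = N u := by
      intro u
      simp only [G]
      rw [hg _ _ hl h3]
      simp only [N, ContinuousLinearMap.comp_apply, e.symmL_apply h3]
      exact (e'.continuousLinearMapAt_apply_of_mem ℂ h4 _).symm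
    have h5 : HasFDerivAt (fun u => G (φ s, u))
        ((fderiv ℂ G (φ s, 0)).comp (ContinuousLinearMap.inr ℂ V F)) 0 :=
      HasFDerivAt.comp (0 : F) (f := fun u : F => (φ s, u)) h1.hasFDerivAt
        (hasFDerivAt_prodMk_right (φ s) 0)
    have h6 : HasFDerivAt (fun u => G (φ s, u)) N 0 := by
      rw [show (fun u => G (φ s, u)) = N from funext hN]
      exact N.hasFDerivAt
    rw [h5.unique h6]
    simp only [N, ContinuousLinearMap.comp_apply, e.symmL_apply h3]
    rw [← e'.symmL_apply (R := ℂ) h4, e'.symmL_continuousLinearMapAt h4]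

namespace HermitianMetric

theorem contDiffAt_localGram (h : HermitianMetric V F E) (s₀ : S) :
    ContDiffAt ℝ 2 (h.localGram s₀) (chartAt V s₀ s₀) := by
  have h1 := (Classical.choose_spec (h.exists_gram (trivializationAt F E s₀))).1
  have h2 := h1.contMDiffAt ((trivializationAt F E s₀).open_baseSet.mem_nhds
    (FiberBundle.mem_baseSet_trivializationAt' s₀))
  have h3 := (contMDiffAt_iff.1 h2).2
  simp only [modelWithCornersSelf_coe, range_id, contDiffWithinAt_univ] at h3
  exact h3

theorem eventually_localGram (h : HermitianMetric V F E) (s₀ : S) :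
    ∀ᶠ s in 𝓝 s₀, (h.localGram s₀ (chartAt V s₀ s)).IsPositive ∧
      IsUnit (h.localGram s₀ (chartAt V s₀ s)) ∧
      ∀ w₁ w₂ : F, h.form s ((trivializationAt F E s₀).symm s w₁)
        ((trivializationAt F E s₀).symm s w₂) =
          inner ℂ w₂ (h.localGram s₀ (chartAt V s₀ s) w₁) := by
  have h1 := (Classical.choose_spec (h.exists_gram (trivializationAt F E s₀))).2
  filter_upwards [(trivializationAt F E s₀).open_baseSet.mem_nhds
    (FiberBundle.mem_baseSet_trivializationAt' s₀),
    (chartAt V s₀).open_source.mem_nhds (mem_chart_source V s₀)] with s h2 h3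
  simp only [localGram, (chartAt V s₀).left_inv h3]
  exact h1 s h2

theorem curvature_symm (h : HermitianMetric V F E) (s : S) (ξ : TangentSpace 𝓘(ℂ, V) s) (w : F) :
    h.curvature s ξ ((trivializationAt F E s).symm s w) = (trivializationAt F E s).symm s
      (LocalChern.curvature (h.localGram s) (chartAt V s s) ξ w) := by
  rw [curvature, Trivialization.apply_mk_symm _ (FiberBundle.mem_baseSet_trivializationAt' s)]

end HermitianMetric

/-- The infimum is itself an admissible bound, because for each `v` the condition on `a` is closed.
-/
theorem pointwiseNorm_le_iff (h : HermitianMetric V F E) (h' : HermitianMetric V F' E')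
    (A : ∀ s, E s →L[ℂ] E' s) (s : S) (M : ℝ≥0) :
    pointwiseNorm h h' A s ≤ M ↔ ∀ v, h'.norm s (A s v) ≤ M * h.norm s v := by
  constructor
  · intro hle v
    have hn : 0 ≤ h.norm s v := Real.sqrt_nonneg _
    refine le_of_forall_pos_le_add fun η hη => ?_
    have hlt : pointwiseNorm h h' A s < (M + Real.toNNReal (η / (h.norm s v + 1)) : ℝ≥0) := by
      refine hle.trans_lt (ENNReal.coe_lt_coe.2 (lt_add_of_pos_right _ ?_))
      simp only [Real.toNNReal_pos]
      positivity
    simp only [pointwiseNorm, iInf_lt_iff] at hlt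
    obtain ⟨a, ha, hlt⟩ := hlt
    have h1 : (a : ℝ) < M + η / (h.norm s v + 1) := by
      have := ENNReal.coe_lt_coe.1 hlt
      rw [← NNReal.coe_lt_coe, NNReal.coe_add, Real.coe_toNNReal _ (by positivity)] at this
      exact this
    calc h'.norm s (A s v) ≤ a * h.norm s v := ha v
      _ ≤ (M + η / (h.norm s v + 1)) * h.norm s v := by gcongr
      _ = M * h.norm s v + η * (h.norm s v / (h.norm s v + 1)) := by ring
      _ ≤ M * h.norm s v + η * 1 := by
        gcongr
        rw [div_le_one (by positivity)]
        linarith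
      _ = _ := by ring
  · intro hv
    exact iInf₂_le M hv

/-- The description of the pointwise norm in terms of local representatives. -/
theorem eventually_pointwiseNorm_le_iff (h : HermitianMetric V F E) (h' : HermitianMetric V F' E')
    {A : ∀ s, E s →L[ℂ] E' s} {s₀ : S} {b : V → F →L[ℂ] F'}
    (hb : ∀ᶠ s in 𝓝 s₀, ∀ w, A s ((trivializationAt F E s₀).symm s w) =
      (trivializationAt F' E' s₀).symm s (b (chartAt V s₀ s) w)) :
    ∀ᶠ s in 𝓝 s₀, ∀ M : ℝ≥0, pointwiseNorm h h' A s ≤ M ↔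
      ∀ w, (inner ℂ (b (chartAt V s₀ s) w)
          (h'.localGram s₀ (chartAt V s₀ s) (b (chartAt V s₀ s) w))).re ≤
        (M : ℝ) ^ 2 * (inner ℂ w (h.localGram s₀ (chartAt V s₀ s) w)).re := by
  filter_upwards [hb, h.eventually_localGram s₀, h'.eventually_localGram s₀,
    (trivializationAt F E s₀).open_baseSet.mem_nhds
    (FiberBundle.mem_baseSet_trivializationAt' s₀)] with s h1 hs hs' h4 M
  obtain ⟨hp, -, h2⟩ := hs
  obtain ⟨-, -, h3⟩ := hs'
  have hsq : ∀ w, h'.norm s (A s ((trivializationAt F E s₀).symm s w)) ≤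
      M * h.norm s ((trivializationAt F E s₀).symm s w) ↔
      (inner ℂ (b (chartAt V s₀ s) w)
          (h'.localGram s₀ (chartAt V s₀ s) (b (chartAt V s₀ s) w))).re ≤
        (M : ℝ) ^ 2 * (inner ℂ w (h.localGram s₀ (chartAt V s₀ s) w)).re := by
    intro w
    rw [h1, HermitianMetric.norm, HermitianMetric.norm, h2, h3]
    have p := hp.re_inner_nonneg_right w
    simp only [RCLike.re_to_complex] at p
    rw [← Real.sqrt_le_sqrt_iff (mul_nonneg (sq_nonneg _) p), Real.sqrt_mul (sq_nonneg _),
      Real.sqrt_sq M.coe_nonneg]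
  rw [pointwiseNorm_le_iff]
  refine ⟨fun H w => (hsq w).1 (H _), fun H v => ?_⟩
  have := (hsq (trivializationAt F E s₀ ⟨s, v⟩).2).2 (H _)
  rwa [Trivialization.symm_apply_apply_mk _ h4] at this

/-- The curvature inequality at a point, in terms of local representatives. -/
theorem DecreasesCurvature.localGram [VectorBundle ℂ F' E'] {h : HermitianMetric V F E}
    {h' : HermitianMetric V F' E'} {A : ∀ s, E s →L[ℂ] E' s} (hcurv : DecreasesCurvature h h' A) {s₀ : S}
    {b : V → F →L[ℂ] F'} (hb : ∀ w, A s₀ ((trivializationAt F E s₀).symm s₀ w) =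
      (trivializationAt F' E' s₀).symm s₀ (b (chartAt V s₀ s₀) w)) (ξ : V) {w : F} {u : F'}
    (hu : b (chartAt V s₀ s₀) w = u) (hne : u ≠ 0) :
    (inner ℂ u (h'.localGram s₀ (chartAt V s₀ s₀)
        (LocalChern.curvature (h'.localGram s₀) (chartAt V s₀ s₀) ξ u))).re /
      (inner ℂ u (h'.localGram s₀ (chartAt V s₀ s₀) u)).re ≤
    (inner ℂ w (h.localGram s₀ (chartAt V s₀ s₀)
        (LocalChern.curvature (h.localGram s₀) (chartAt V s₀ s₀) ξ w))).re /
      (inner ℂ w (h.localGram s₀ (chartAt V s₀ s₀) w)).re := by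
  have hmem' : s₀ ∈ (trivializationAt F' E' s₀).baseSet :=
    FiberBundle.mem_baseSet_trivializationAt' s₀
  have hne' : (trivializationAt F' E' s₀).symm s₀ u ≠ 0 := by
    intro h0
    apply hne
    have h1 := (trivializationAt F' E' s₀).continuousLinearMapAt_symmL (R := ℂ) hmem' u
    rw [(trivializationAt F' E' s₀).symmL_apply hmem', h0, map_zero] at h1
    exact h1.symm
  obtain ⟨-, -, h2⟩ := (h.eventually_localGram s₀).self_of_nhds
  obtain ⟨-, -, h2'⟩ := (h'.eventually_localGram s₀).self_of_nhds
  have := hcurv s₀ ξ ((trivializationAt F E s₀).symm s₀ w)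
  rw [hb, hu] at this
  have := this hne'
  have c1 := h.curvature_symm s₀ ξ w
  have c2 := h'.curvature_symm s₀ ξ u
  erw [c1, c2, h2, h2, h2', h2'] at this
  exact this

end LocalModel

/-! ### Finiteness and upper semicontinuity of the norm -/

/-- The margin `κ‖w‖²` absorbs a change of `P - Q` of operator norm less than `κ`, for all `w` at
once. -/
theorem eventually_forall_re_inner_le {X F : Type*} [TopologicalSpace X] [NormedAddCommGroup F]
    [InnerProductSpace ℂ F] {P Q : X → F →L[ℂ] F} {x₀ : X} (hP : ContinuousAt P x₀)
    (hQ : ContinuousAt Q x₀) {κ : ℝ} (hκ : 0 < κ)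
    (h : ∀ w, (inner ℂ w (Q x₀ w)).re + κ * ‖w‖ ^ 2 ≤ (inner ℂ w (P x₀ w)).re) :
    ∀ᶠ x in 𝓝 x₀, ∀ w, (inner ℂ w (Q x w)).re ≤ (inner ℂ w (P x w)).re := by
  have hB := Metric.tendsto_nhds.1 (hP.sub hQ).tendsto κ hκ
  filter_upwards [hB] with x hx w
  rw [dist_eq_norm] at hx
  have h1 : |(inner ℂ w ((P x - Q x - (P x₀ - Q x₀)) w)).re| ≤ κ * ‖w‖ ^ 2 := by
    calc _ ≤ ‖inner ℂ w ((P x - Q x - (P x₀ - Q x₀)) w)‖ := Complex.abs_re_le_norm _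
      _ ≤ ‖w‖ * ‖(P x - Q x - (P x₀ - Q x₀)) w‖ := norm_inner_le_norm _ _
      _ ≤ ‖w‖ * (κ * ‖w‖) := by
        gcongr
        exact (ContinuousLinearMap.le_opNorm _ w).trans (by gcongr; exact hx.le)
      _ = _ := by ring
  have h2 := (abs_le.1 h1).1
  simp only [_root_.sub_apply, inner_sub_right, Complex.sub_re] at h2
  linarith [h w]

section Semicontinuity

variable {V : Type*} [NormedAddCommGroup V] [NormedSpace ℂ V]
  {S : Type*} [TopologicalSpace S] [ChartedSpace V S] [IsManifold 𝓘(ℂ, V) ω S]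
  {F : Type*} [NormedAddCommGroup F] [InnerProductSpace ℂ F] [CompleteSpace F]
  {E : S → Type*} [∀ s, AddCommGroup (E s)] [∀ s, Module ℂ (E s)]
  [∀ s, TopologicalSpace (E s)] [TopologicalSpace (TotalSpace F E)] [FiberBundle F E]
  [VectorBundle ℂ F E] [ContMDiffVectorBundle ω F E 𝓘(ℂ, V)]
  {F' : Type*} [NormedAddCommGroup F'] [InnerProductSpace ℂ F'] [CompleteSpace F']
  {E' : S → Type*} [∀ s, AddCommGroup (E' s)] [∀ s, Module ℂ (E' s)]
  [∀ s, TopologicalSpace (E' s)] [TopologicalSpace (TotalSpace F' E')] [FiberBundle F' E']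
  [VectorBundle ℂ F' E'] [ContMDiffVectorBundle ω F' E' 𝓘(ℂ, V)]
  (h : HermitianMetric V F E) (h' : HermitianMetric V F' E') {A : ∀ s, E s →L[ℂ] E' s}

theorem pointwiseNorm_lt_top
    (hA : ContMDiff (𝓘(ℂ, V).prod 𝓘(ℂ, F)) (𝓘(ℂ, V).prod 𝓘(ℂ, F')) ω
      (fun x : TotalSpace F E => (⟨x.1, A x.1 x.2⟩ : TotalSpace F' E'))) (s₀ : S) :
    pointwiseNorm h h' A s₀ < ⊤ := by
  obtain ⟨b, -, hb⟩ := exists_contDiffAt_representative hA s₀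
  have hle := (eventually_pointwiseNorm_le_iff h h' hb).self_of_nhds
  obtain ⟨hp, hu, -⟩ := (h.eventually_localGram s₀).self_of_nhds
  obtain ⟨κ, hκ, hcoer⟩ := hp.exists_le_re_inner_of_isUnit hu
  set y₀ := chartAt V s₀ s₀
  set Q := pullbackForm (h'.localGram s₀ y₀) (b y₀) with hQ
  refine lt_of_le_of_lt ((hle (Real.toNNReal (Real.sqrt (‖Q‖ / κ)))).2 fun w => ?_)
    ENNReal.coe_lt_top
  rw [← inner_pullbackForm, Real.coe_toNNReal _ (Real.sqrt_nonneg _), Real.sq_sqrt (by positivity)]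
  calc (inner ℂ w (Q w)).re ≤ ‖inner ℂ w (Q w)‖ := Complex.re_le_norm _
    _ ≤ ‖w‖ * ‖Q w‖ := norm_inner_le_norm _ _
    _ ≤ ‖w‖ * (‖Q‖ * ‖w‖) := by gcongr; exact Q.le_opNorm w
    _ = ‖Q‖ / κ * (κ * ‖w‖ ^ 2) := by field_simp
    _ ≤ _ := by gcongr; exact hcoer w

theorem upperSemicontinuous_pointwiseNorm
    (hA : ContMDiff (𝓘(ℂ, V).prod 𝓘(ℂ, F)) (𝓘(ℂ, V).prod 𝓘(ℂ, F')) ω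
      (fun x : TotalSpace F E => (⟨x.1, A x.1 x.2⟩ : TotalSpace F' E'))) :
    UpperSemicontinuous (pointwiseNorm h h' A) := by
  intro s₀ y hy
  obtain ⟨M, hM, hMy⟩ := ENNReal.lt_iff_exists_nnreal_btwn.1 hy
  -- The bound `m` holds at `s₀`; the gap `M² - m²`, times the coercivity constant of `P`, is the
  -- margin that gives the bound `M` nearby.
  obtain ⟨m, hm, hmM⟩ := ENNReal.lt_iff_exists_nnreal_btwn.1 hM
  have hmM' : (m : ℝ) < M := by exact_mod_cast hmM
  obtain ⟨b, hbC, hb⟩ := exists_contDiffAt_representative hA s₀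
  have hle := eventually_pointwiseNorm_le_iff h h' hb
  obtain ⟨hp, hu, -⟩ := (h.eventually_localGram s₀).self_of_nhds
  obtain ⟨κ, hκ, hcoer⟩ := hp.exists_le_re_inner_of_isUnit hu
  have hφ : ContinuousAt (chartAt V s₀) s₀ :=
    (chartAt V s₀).continuousAt (mem_chart_source V s₀)
  have cP : ContinuousAt (fun y => ((M : ℂ) ^ 2) • h.localGram s₀ y) (chartAt V s₀ s₀) :=
    ((h.contDiffAt_localGram s₀).continuousAt.const_smul ((M : ℂ) ^ 2) :)
  have cQ : ContinuousAt (fun y => pullbackForm (h'.localGram s₀ y) (b y)) (chartAt V s₀ s₀) :=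
    ((h'.contDiffAt_localGram s₀).pullbackForm (hbC.restrict_scalars ℝ)).continuousAt
  have hM2 : ∀ z : ℂ, ((M : ℂ) ^ 2 * z).re = (M : ℝ) ^ 2 * z.re := by
    intro z
    rw [show ((M : ℂ) ^ 2 : ℂ) = (((M : ℝ) ^ 2 : ℝ) : ℂ) by push_cast; rfl,
      Complex.re_ofReal_mul]
  have hpos : (0 : ℝ) < (M : ℝ) ^ 2 - (m : ℝ) ^ 2 :=
    sub_pos.2 (pow_lt_pow_left₀ hmM' m.coe_nonneg two_ne_zero)
  have ev := eventually_forall_re_inner_le (P := fun s => ((M : ℂ) ^ 2) • h.localGram s₀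
      (chartAt V s₀ s)) (Q := fun s => pullbackForm (h'.localGram s₀ (chartAt V s₀ s))
      (b (chartAt V s₀ s))) (x₀ := s₀) (κ := ((M : ℝ) ^ 2 - (m : ℝ) ^ 2) * κ)
    (ContinuousAt.comp (f := chartAt V s₀) cP hφ) (ContinuousAt.comp (f := chartAt V s₀) cQ hφ)
    (by positivity) (by
      intro w
      have h1 := (hle.self_of_nhds m).1 hm.le w
      rw [← inner_pullbackForm] at h1
      simp only [_root_.smul_apply, inner_smul_right, hM2]
      nlinarith [mul_le_mul_of_nonneg_left (hcoer w) hpos.le])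
  filter_upwards [ev, hle] with s h1 h2
  refine lt_of_le_of_lt ((h2 M).2 fun w => ?_) hMy
  have := h1 w
  simpa only [_root_.smul_apply, inner_smul_right, hM2, inner_pullbackForm] using this

end Semicontinuity

/-! ### No strict maximum along a holomorphic curve -/

section CurveMaximum

variable {V : Type*} [NormedAddCommGroup V] [NormedSpace ℂ V]
  {S : Type*} [TopologicalSpace S] [ChartedSpace V S] [IsManifold 𝓘(ℂ, V) ω S]
  {F : Type*} [NormedAddCommGroup F] [InnerProductSpace ℂ F] [CompleteSpace F]
  {E : S → Type*} [∀ s, AddCommGroup (E s)] [∀ s, Module ℂ (E s)]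
  [∀ s, TopologicalSpace (E s)] [TopologicalSpace (TotalSpace F E)] [FiberBundle F E]
  [VectorBundle ℂ F E] [ContMDiffVectorBundle ω F E 𝓘(ℂ, V)]
  {F' : Type*} [NormedAddCommGroup F'] [InnerProductSpace ℂ F'] [CompleteSpace F']
  {E' : S → Type*} [∀ s, AddCommGroup (E' s)] [∀ s, Module ℂ (E' s)]
  [∀ s, TopologicalSpace (E' s)] [TopologicalSpace (TotalSpace F' E')] [FiberBundle F' E']
  [VectorBundle ℂ F' E'] [ContMDiffVectorBundle ω F' E' 𝓘(ℂ, V)]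
  {h : HermitianMetric V F E} {h' : HermitianMetric V F' E'} {A : ∀ s, E s →L[ℂ] E' s}

/-- Along a holomorphic curve, `|A|` times `exp (ε |z|² - g)`, with `g` harmonic, has no positive
local maximum. -/
theorem not_isLocalMax_mul_exp
    (hA : ContMDiff (𝓘(ℂ, V).prod 𝓘(ℂ, F)) (𝓘(ℂ, V).prod 𝓘(ℂ, F')) ω
      (fun x : TotalSpace F E => (⟨x.1, A x.1 x.2⟩ : TotalSpace F' E')))
    (hcurv : DecreasesCurvature h h' A) {f : ℂ → S} {z₀ : ℂ}
    (hf : ContMDiffAt 𝓘(ℂ, ℂ) 𝓘(ℂ, V) ω f z₀) {g : ℂ → ℝ} (hg : HarmonicAt g z₀) {ε : ℝ}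
    (hε : 0 < ε) (hpos : 0 < (pointwiseNorm h h' A (f z₀)).toReal)
    (hmax : IsLocalMax (fun z => (pointwiseNorm h h' A (f z)).toReal *
      Real.exp (-g z + ε * ‖z‖ ^ 2)) z₀) : False := by
  set s₀ := f z₀ with hs₀
  set N : ℂ → ℝ := fun z => (pointwiseNorm h h' A (f z)).toReal with hN
  obtain ⟨b, hbC, hb⟩ := exists_contDiffAt_representative hA s₀
  have hle := eventually_pointwiseNorm_le_iff h h' hb
  have hfc : Tendsto f (𝓝 z₀) (𝓝 s₀) := hf.continuousAt
  set γ : ℂ → V := fun z => chartAt V s₀ (f z) with hγ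
  have hγC : ContDiffAt ℂ 2 γ z₀ := by
    have h1 := (contMDiffAt_iff.1 hf).2
    simp only [extChartAt_self_eq, modelWithCornersSelf_coe, range_id,
      contDiffWithinAt_univ] at h1
    exact ContDiffAt.of_le (n := ω) h1 (by simp)
  -- a holomorphic function with real part `g`
  obtain ⟨ρ, hρ, hball⟩ := Metric.eventually_nhds_iff_ball.1
    ((isOpen_setOfPred_harmonicAt g).mem_nhds hg)
  obtain ⟨G, hG, hGre⟩ := HarmonicOnNhd.exists_analyticOnNhd_ball_re_eq hball
  have hG0 : ContDiffAt ℂ 2 G z₀ := (hG z₀ (Metric.mem_ball_self hρ)).contDiffAt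
  -- From `|z|² = |z - z₀|² + Re(2 z̄₀z - |z₀|²)`: the harmonic part of `-g + ε|z|²` is `-Re Γ`, and
  -- `ε|z - z₀|²` remains.
  set Γ : ℂ → ℂ := fun z => G z - ε * (2 * (starRingEnd ℂ z₀ * z) - (‖z₀‖ : ℂ) ^ 2) with hΓ
  have hΓC : ContDiffAt ℂ 2 Γ z₀ := by
    simp only [hΓ]; fun_prop
  have hΓre : ∀ᶠ z in 𝓝 z₀, (-Γ z).re = -g z + ε * ‖z‖ ^ 2 - ε * ‖z - z₀‖ ^ 2 := by
    filter_upwards [Metric.ball_mem_nhds z₀ hρ] with z hz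
    have h1 : (G z).re = g z := hGre hz
    have h2 : ∀ w : ℂ, ‖w‖ ^ 2 = w.re * w.re + w.im * w.im := fun w => by
      rw [Complex.sq_norm, Complex.normSq_apply]
    have h3 : (((‖z₀‖ : ℂ)) ^ 2).re = ‖z₀‖ ^ 2 := by norm_cast
    simp only [hΓ, Complex.neg_re, Complex.sub_re, Complex.re_ofReal_mul, h1, h3]
    rw [show (2 : ℂ) = ((2 : ℝ) : ℂ) by norm_num, Complex.re_ofReal_mul]
    simp only [h2, Complex.mul_re, Complex.conj_re, Complex.conj_im, Complex.sub_re,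
      Complex.sub_im]
    ring
  set a : ℂ → F →L[ℂ] F' := fun z => Complex.exp (-Γ z) • b (γ z) with ha
  have haC : ContDiffAt ℂ 2 a z₀ := hΓC.neg.cexp.smul (hbC.comp z₀ hγC)
  set P : ℂ → F →L[ℂ] F := fun z => h.localGram s₀ (γ z) with hPdef
  set P' : ℂ → F' →L[ℂ] F' := fun z => h'.localGram s₀ (γ z) with hP'def
  have hPγ := h.contDiffAt_localGram s₀
  have hPγ' := h'.contDiffAt_localGram s₀
  have hPC : ContDiffAt ℝ 2 P z₀ :=
    ContDiffAt.comp z₀ (f := γ) hPγ (hγC.restrict_scalars ℝ)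
  have hPC' : ContDiffAt ℝ 2 P' z₀ :=
    ContDiffAt.comp z₀ (f := γ) hPγ' (hγC.restrict_scalars ℝ)
  have hpos1 : ∀ᶠ z in 𝓝 z₀, (P z).IsPositive ∧ IsUnit (P z) :=
    (hfc.eventually (h.eventually_localGram s₀)).mono fun z hz => ⟨hz.1, hz.2.1⟩
  have hpos1' : ∀ᶠ z in 𝓝 z₀, (P' z).IsPositive ∧ IsUnit (P' z) :=
    (hfc.eventually (h'.eventually_localGram s₀)).mono fun z hz => ⟨hz.1, hz.2.1⟩
  have hsq : ∀ z v, (inner ℂ (a z v) (P' z (a z v))).re =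
      Real.exp ((-Γ z).re) ^ 2 * (inner ℂ (b (γ z) v) (P' z (b (γ z) v))).re := by
    intro z v
    simp only [ha, _root_.smul_apply, map_smul, inner_smul_left, inner_smul_right, ← mul_assoc]
    rw [mul_comm (Complex.exp (-Γ z)) (starRingEnd ℂ _), ← Complex.normSq_eq_conj_mul_self,
      Complex.re_ofReal_mul, ← Complex.sq_norm, Complex.norm_exp]
  have hNle : ∀ᶠ z in 𝓝 z₀, ∀ M : ℝ, 0 ≤ M → (N z ≤ M ↔
      ∀ v, (inner ℂ (b (γ z) v) (P' z (b (γ z) v))).re ≤ M ^ 2 * (inner ℂ v (P z v)).re) := by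
    filter_upwards [hfc.eventually hle] with z hz M hM
    have := hz (Real.toNNReal M)
    rw [Real.coe_toNNReal _ hM] at this
    rw [← this, hN, ← ENNReal.ofReal, ENNReal.le_ofReal_iff_toReal_le
      (pointwiseNorm_lt_top h h' hA _).ne hM]
  set e₀ := Real.exp (-g z₀ + ε * ‖z₀‖ ^ 2) with he₀
  have he₀pos : 0 < e₀ := Real.exp_pos _
  have hΓ0 : Real.exp ((-Γ z₀).re) = e₀ := by
    rw [hΓre.self_of_nhds, he₀]; simp
  obtain ⟨hp0, hu0⟩ := hpos1.self_of_nhds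
  obtain ⟨κ, hκ, hcoer⟩ := hp0.exists_le_re_inner_of_isUnit hu0
  refine LocalChern.not_strict_max_of_curvature_le hPC hPC' haC hpos1 hpos1'
    (c := (N z₀ * e₀) ^ 2) (ε := ε) (pow_pos (mul_pos hpos he₀pos) 2) hε ?_ ?_ ?_
  · have hsmall : ∀ᶠ z in 𝓝 z₀, ε * ‖z - z₀‖ ^ 2 < 1 / 2 := by
      have h1 : Tendsto (fun z => ε * ‖z - z₀‖ ^ 2) (𝓝 z₀) (𝓝 0) := by
        have : Continuous fun z => ε * ‖z - z₀‖ ^ 2 := by fun_prop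
        simpa using this.tendsto z₀
      exact h1.eventually_lt_const (by norm_num)
    filter_upwards [hsmall, hNle, hΓre, hmax, hpos1] with z h1 h2 h3 h4 h5 v
    set x := ε * ‖z - z₀‖ ^ 2 with hx
    have hx0 : 0 ≤ x := by positivity
    have hp : 0 ≤ (inner ℂ v (P z v)).re := h5.1.re_inner_nonneg_right v
    have h6 := (h2 (N z) ENNReal.toReal_nonneg).1 le_rfl v
    -- This turns the Gaussian decay into the polynomial factor of the lemma; it uses `x < 1/2`.
    have h7 : Real.exp (-x) ^ 2 ≤ 1 - x := by
      have h8 := Real.add_one_le_exp x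
      have h9 : Real.exp (-x) ≤ 1 / (1 + x) := by
        rw [Real.exp_neg, ← one_div]
        exact one_div_le_one_div_of_le (by linarith) (by linarith)
      calc Real.exp (-x) ^ 2 ≤ (1 / (1 + x)) ^ 2 := by gcongr
        _ ≤ 1 - x := by
          rw [div_pow, one_pow, div_le_iff₀ (by positivity)]
          nlinarith [mul_nonneg hx0 hx0]
    have h10 : Real.exp ((-Γ z).re) = Real.exp (-g z + ε * ‖z‖ ^ 2) * Real.exp (-x) := by
      rw [h3, sub_eq_add_neg, Real.exp_add]
    rw [hsq, h10]
    have hN0 : 0 ≤ N z := ENNReal.toReal_nonneg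
    calc _ ≤ (Real.exp (-g z + ε * ‖z‖ ^ 2) * Real.exp (-x)) ^ 2 *
          (N z ^ 2 * (inner ℂ v (P z v)).re) := by gcongr
      _ = (N z * Real.exp (-g z + ε * ‖z‖ ^ 2)) ^ 2 * Real.exp (-x) ^ 2 *
          (inner ℂ v (P z v)).re := by ring
      _ ≤ (N z₀ * e₀) ^ 2 * (1 - x) * (inner ℂ v (P z v)).re := by
        gcongr
  · intro δ hδ
    -- `M` lies below the norm at `z₀`, so some `v` violates the bound `M`; normalized, it is
    -- extremal up to `δ`, since `e₀²M² ≥ c - δ`.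
    set M := Real.sqrt (max 0 (N z₀ ^ 2 - δ / e₀ ^ 2)) with hM
    have hM2 : M ^ 2 = max 0 (N z₀ ^ 2 - δ / e₀ ^ 2) := Real.sq_sqrt (le_max_left _ _)
    have hMN : M < N z₀ := by
      refine lt_of_pow_lt_pow_left₀ 2 hpos.le ?_
      rw [hM2]
      have : 0 < δ / e₀ ^ 2 := by positivity
      exact max_lt (pow_pos hpos 2) (by linarith)
    have h1 : ¬ ∀ v, (inner ℂ (b (γ z₀) v) (P' z₀ (b (γ z₀) v))).re ≤
        M ^ 2 * (inner ℂ v (P z₀ v)).re := by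
      rw [← hNle.self_of_nhds M (Real.sqrt_nonneg _)]
      exact not_le.2 hMN
    push Not at h1
    obtain ⟨v, hv⟩ := h1
    have hv0 : v ≠ 0 := by
      rintro rfl
      simp at hv
    have hq : 0 < (inner ℂ v (P z₀ v)).re :=
      lt_of_lt_of_le (by have := norm_pos_iff.2 hv0; positivity) (hcoer v)
    set q := (inner ℂ v (P z₀ v)).re with hqdef
    set r : ℝ := (Real.sqrt q)⁻¹ with hr
    have hr2 : r * r = 1 / q := by
      rw [hr, ← mul_inv, Real.mul_self_sqrt hq.le, one_div]
    have hscale : ∀ z : ℂ, ((r : ℂ) * ((r : ℂ) * z)).re = 1 / q * z.re := by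
      intro z
      rw [Complex.re_ofReal_mul, Complex.re_ofReal_mul, ← mul_assoc, hr2]
    refine ⟨(r : ℂ) • v, ?_, ?_⟩
    · simp only [map_smul, inner_smul_left, inner_smul_right, Complex.conj_ofReal, hscale]
      rw [← hqdef]
      field_simp
    · rw [hsq, hΓ0]
      simp only [map_smul, inner_smul_left, inner_smul_right, Complex.conj_ofReal, hscale]
      have h2 : M ^ 2 ≤ 1 / q * (inner ℂ (b (γ z₀) v) (P' z₀ (b (γ z₀) v))).re := by
        rw [one_div, inv_mul_eq_div, le_div_iff₀ hq]
        exact hv.le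
      calc (N z₀ * e₀) ^ 2 - δ = e₀ ^ 2 * (N z₀ ^ 2 - δ / e₀ ^ 2) := by field_simp
        _ ≤ e₀ ^ 2 * M ^ 2 := by gcongr; rw [hM2]; exact le_max_right _ _
        _ ≤ _ := by gcongr
  · intro v hv
    have hnz : b (γ z₀) v ≠ 0 := by
      intro h0
      apply hv
      simp [ha, h0]
    have h1 := hcurv.localGram hb.self_of_nhds (deriv γ z₀) (w := v) rfl hnz
    have hexp : (Real.exp ((-Γ z₀).re)) ^ 2 ≠ 0 := by positivity
    have e1 : LocalChern.curvature P z₀ 1 v =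
        LocalChern.curvature (h.localGram s₀) (γ z₀) (deriv γ z₀) v :=
      LocalChern.curvature_comp (P := h.localGram s₀) hPγ hu0 hγC v
    have e2 : LocalChern.curvature P' z₀ 1 (a z₀ v) = Complex.exp (-Γ z₀) •
        LocalChern.curvature (h'.localGram s₀) (γ z₀) (deriv γ z₀) (b (γ z₀) v) := by
      rw [show a z₀ v = Complex.exp (-Γ z₀) • b (γ z₀) v from rfl,
        LocalChern.curvature_smul hPC' hpos1'.self_of_nhds.2]
      congr 1
      exact LocalChern.curvature_comp (P := h'.localGram s₀) hPγ' hpos1'.self_of_nhds.2 hγC _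
    rw [hsq, e1, e2]
    have e3 : (inner ℂ (a z₀ v) (P' z₀ (Complex.exp (-Γ z₀) •
        LocalChern.curvature (h'.localGram s₀) (γ z₀) (deriv γ z₀) (b (γ z₀) v)))).re =
        Real.exp ((-Γ z₀).re) ^ 2 * (inner ℂ (b (γ z₀) v) (P' z₀
          (LocalChern.curvature (h'.localGram s₀) (γ z₀) (deriv γ z₀) (b (γ z₀) v)))).re := by
      simp only [ha, _root_.smul_apply, map_smul, inner_smul_left, inner_smul_right, ← mul_assoc]
      rw [mul_comm (Complex.exp (-Γ z₀)) (starRingEnd ℂ _), ← Complex.normSq_eq_conj_mul_self,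
        Complex.re_ofReal_mul, ← Complex.sq_norm, Complex.norm_exp]
    rw [e3, mul_div_mul_left _ _ hexp]
    exact h1

end CurveMaximum

/-! ### Plurisubharmonicity of the logarithm of the norm -/

section Subharmonic

variable {V : Type*} [NormedAddCommGroup V] [NormedSpace ℂ V]
  {S : Type*} [TopologicalSpace S] [ChartedSpace V S] [IsManifold 𝓘(ℂ, V) ω S]
  {F : Type*} [NormedAddCommGroup F] [InnerProductSpace ℂ F] [CompleteSpace F]
  {E : S → Type*} [∀ s, AddCommGroup (E s)] [∀ s, Module ℂ (E s)]
  [∀ s, TopologicalSpace (E s)] [TopologicalSpace (TotalSpace F E)] [FiberBundle F E]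
  [VectorBundle ℂ F E] [ContMDiffVectorBundle ω F E 𝓘(ℂ, V)]
  {F' : Type*} [NormedAddCommGroup F'] [InnerProductSpace ℂ F'] [CompleteSpace F']
  {E' : S → Type*} [∀ s, AddCommGroup (E' s)] [∀ s, Module ℂ (E' s)]
  [∀ s, TopologicalSpace (E' s)] [TopologicalSpace (TotalSpace F' E')] [FiberBundle F' E']
  [VectorBundle ℂ F' E'] [ContMDiffVectorBundle ω F' E' 𝓘(ℂ, V)]
  {h : HermitianMetric V F E} {h' : HermitianMetric V F' E'} {A : ∀ s, E s →L[ℂ] E' s}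

theorem plurisubharmonic_log_pointwiseNorm
    (hA : ContMDiff (𝓘(ℂ, V).prod 𝓘(ℂ, F)) (𝓘(ℂ, V).prod 𝓘(ℂ, F')) ω
      (fun x : TotalSpace F E => (⟨x.1, A x.1 x.2⟩ : TotalSpace F' E')))
    (hcurv : DecreasesCurvature h h' A) :
    Plurisubharmonic V (fun s => ENNReal.log (pointwiseNorm h h' A s)) := by
  have husc : UpperSemicontinuous (fun s => ENNReal.log (pointwiseNorm h h' A s)) :=
    ENNReal.continuous_log.comp_upperSemicontinuous
      (upperSemicontinuous_pointwiseNorm h h' hA) ENNReal.log_monotone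
  have htop : ∀ s, pointwiseNorm h h' A s < ⊤ := pointwiseNorm_lt_top h h' hA
  have htop' : ∀ s, ENNReal.log (pointwiseNorm h h' A s) < ⊤ := fun s =>
    ENNReal.log_lt_top_iff.2 (htop s)
  refine ⟨husc, htop', fun D f hD hf => ?_⟩
  have huscf : UpperSemicontinuousOn (fun z => ENNReal.log (pointwiseNorm h h' A (f z))) D :=
    fun z hz y hy => (hf.continuousOn z hz).eventually (husc (f z) y hy)
  refine ⟨huscf, fun z _ => htop' _, ?_⟩
  intro K hKD hK g hg hharm hle z₁ hz₁
  by_contra! hlt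
  obtain ⟨y, hy1, hy2⟩ := EReal.lt_iff_exists_real_btwn.1 hlt
  have hy1' : g z₁ < y := by exact_mod_cast hy1
  obtain ⟨R, hR⟩ := hK.isBounded.exists_norm_le
  -- So small that on `K` the term `ε|z|²` stays below the gap `y - g z₁`; hence the maximum point
  -- cannot lie on the frontier.
  set ε : ℝ := (y - g z₁) / (R ^ 2 + 1) with hε
  have hε0 : 0 < ε := div_pos (sub_pos.2 hy1') (by positivity)
  have hεR : ε * R ^ 2 < y - g z₁ := by
    rw [hε, div_mul_eq_mul_div, div_lt_iff₀ (by positivity)]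
    nlinarith
  set c : ℂ → ℝ := fun z => -g z + ε * ‖z‖ ^ 2 with hc
  have hcK : ContinuousOn (fun z => ((c z : ℝ) : EReal)) K := by
    refine continuous_coe_real_ereal.comp_continuousOn ?_
    exact hg.neg.add (by fun_prop)
  have hΨ : UpperSemicontinuousOn
      (fun z => ENNReal.log (pointwiseNorm h h' A (f z)) + (c z : EReal)) K :=
    UpperSemicontinuousOn.add' (fun z hz => (huscf z (hKD hz)).mono hKD) hcK.upperSemicontinuousOn
      fun z _ => EReal.continuousAt_add (Or.inl (htop' _).ne) (Or.inr (EReal.coe_ne_top _))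
  obtain ⟨z₀, hz₀, hmax⟩ := hΨ.exists_isMaxOn ⟨z₁, hz₁⟩ hK
  have hlarge : ((y - g z₁ : ℝ) : EReal) ≤
      ENNReal.log (pointwiseNorm h h' A (f z₀)) + (c z₀ : EReal) := by
    refine le_trans ?_ (hmax hz₁)
    calc ((y - g z₁ : ℝ) : EReal) ≤ (y : EReal) + (c z₁ : EReal) := by
          rw [← EReal.coe_add, EReal.coe_le_coe_iff]
          have : 0 ≤ ε * ‖z₁‖ ^ 2 := by positivity
          simp only [hc]
          linarith
      _ ≤ _ := add_le_add_left hy2.le _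
  by_cases hfr : z₀ ∈ frontier K
  · have h1 : ENNReal.log (pointwiseNorm h h' A (f z₀)) + (c z₀ : EReal) ≤
        ((g z₀ + c z₀ : ℝ) : EReal) := by
      rw [EReal.coe_add]
      exact add_le_add_left (hle z₀ hfr) _
    have h2 := EReal.coe_le_coe_iff.1 (hlarge.trans h1)
    have h3 : ε * ‖z₀‖ ^ 2 ≤ ε * R ^ 2 := by
      gcongr
      exact hR z₀ hz₀
    simp only [hc] at h2
    linarith
  · have hint : z₀ ∈ interior K := by
      by_contra hni
      exact hfr ⟨subset_closure hz₀, hni⟩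
    refine not_isLocalMax_mul_exp hA hcurv (hf.contMDiffAt (hD.mem_nhds (hKD hz₀)))
      (hharm z₀ hint) hε0 (ENNReal.toReal_pos ?_ (htop _).ne) ?_
    · intro h0
      rw [h0, ENNReal.log_zero, EReal.bot_add] at hlarge
      exact absurd (le_bot_iff.1 hlarge) (EReal.coe_ne_bot _)
    · filter_upwards [mem_interior_iff_mem_nhds.1 hint] with z hz
      have h1 := EReal.exp_monotone (hmax hz)
      simp only [EReal.exp_add, ENNReal.exp_log, EReal.exp_coe] at h1
      have h2 := ENNReal.toReal_mono
        (ENNReal.mul_ne_top (htop _).ne ENNReal.ofReal_ne_top) h1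
      simpa only [ENNReal.toReal_mul, ENNReal.toReal_ofReal (Real.exp_nonneg _)] using h2

end Subharmonic

/-! ### The maximum principle for plurisubharmonic functions -/

section MaximumPrinciple

/-- The strong maximum principle on a disc: if the value at the centre is maximal, then so is the
value at `1`. -/
theorem SubharmonicOn.eq_of_isMax_center {u : ℂ → EReal}
    (hu : SubharmonicOn u (Metric.ball 0 4)) {M : EReal} (h0 : u 0 = M)
    (hM : ∀ z ∈ Metric.ball (0 : ℂ) 4, u z ≤ M) : u 1 = M := by
  obtain ⟨husc, htop, hmaj⟩ := hu
  by_contra hne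
  have h1lt : u 1 < M := lt_of_le_of_ne (hM 1 (by simp)) hne
  have hsub : ∀ z : ℂ, dist z 1 ≤ 2 → z ∈ Metric.ball (0 : ℂ) 4 := by
    intro z hz
    have := dist_triangle z 1 0
    rw [Metric.mem_ball]
    simp only [dist_zero_right, norm_one] at this ⊢
    linarith
  have hMtop : M < ⊤ := h0 ▸ htop 0 (by simp)
  lift M to ℝ using ⟨hMtop.ne, (bot_le.trans_lt h1lt).ne'⟩
  have hcb : UpperSemicontinuousOn u (Metric.closedBall 1 2) :=
    fun z hz => (husc z (hsub z hz)).mono fun w hw => hsub w hw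
  -- `b` is a point closest to `1` where `u` reaches `M`, so `u < M` on the open disc of radius `r`
  -- about `1`, where `0 < r ≤ 1`.
  obtain ⟨b, ⟨hb2, hbM⟩, hbmin⟩ :=
    (hcb.isCompact_inter_preimage_Ici (isCompact_closedBall (1 : ℂ) 2) (M : EReal)).exists_isMinOn
      ⟨0, by simp, by simp [h0]⟩ (f := fun z => dist z 1) (by fun_prop)
  set r := dist b 1 with hr
  have hr1 : r ≤ 1 := by
    have := hbmin (show (0 : ℂ) ∈ Metric.closedBall 1 2 ∩ u ⁻¹' Ici (M : EReal) from
      ⟨by simp, by simp [h0]⟩)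
    simpa using this
  have hr0 : 0 < r := by
    refine dist_pos.2 ?_
    rintro rfl
    exact absurd h1lt (not_lt.2 hbM)
  have hin : ∀ z, dist z 1 < r → u z < M := by
    intro z hz
    by_contra! hge
    exact absurd (hbmin (show z ∈ Metric.closedBall 1 2 ∩ u ⁻¹' Ici (M : EReal) from
      ⟨by rw [Metric.mem_closedBall]; linarith, hge⟩)) (not_le.2 hz)
  -- the maximum on a small circle
  obtain ⟨zs, hzs, hzmax⟩ := UpperSemicontinuousOn.exists_isMaxOn
    (s := Metric.sphere (1 : ℂ) (r / 2)) (NormedSpace.sphere_nonempty.2 (by linarith))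
    (isCompact_sphere _ _) (fun z hz => (hcb z (by
      rw [Metric.mem_closedBall, Metric.mem_sphere.1 hz]; linarith)).mono fun w hw => by
        rw [Metric.mem_closedBall, Metric.mem_sphere.1 hw]; linarith)
  obtain ⟨m, hm1, hm2⟩ := EReal.lt_iff_exists_real_btwn.1
    (hin zs (by rw [Metric.mem_sphere.1 hzs]; linarith))
  have hmM : m < M := by exact_mod_cast hm2
  have hlog : Real.log (r / 2) < Real.log 2 := Real.log_lt_log (by linarith) (by linarith)
  set η := (M - m) / (Real.log 2 - Real.log (r / 2)) with hη
  have hη0 : 0 < η := div_pos (by linarith) (by linarith)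
  -- Barrier on the annulus `r/2 ≤ |z - 1| ≤ 2`: it equals `M` on the outer circle and `m` on the
  -- inner one, and it is less than `M` at `b`.
  set g : ℂ → ℝ := fun z => (M - η * Real.log 2) + η * Real.log ‖z - 1‖ with hg
  set K : Set ℂ := {z | r / 2 ≤ dist z 1 ∧ dist z 1 ≤ 2} with hK
  have hd : Continuous fun z : ℂ => dist z 1 := by fun_prop
  have hKcl : IsClosed K :=
    (isClosed_le continuous_const hd).inter (isClosed_le hd continuous_const)
  have hKc : IsCompact K :=
    (isCompact_closedBall (1 : ℂ) 2).of_isClosed_subset hKcl fun z hz => hz.2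
  have hKne : ∀ z ∈ K, z - 1 ≠ 0 := by
    intro z hz
    rw [sub_ne_zero]
    rintro rfl
    have := hz.1
    rw [dist_self] at this
    linarith
  have hgK : ∀ z, z - 1 ≠ 0 → HarmonicAt g z := by
    intro z hz
    have h1 : HarmonicAt (fun z : ℂ => Real.log ‖z - 1‖) z :=
      AnalyticAt.harmonicAt_log_norm (f := fun z => z - 1) (by fun_prop) hz
    exact (harmonicAt_const (M - η * Real.log 2)).add (h1.const_smul (c := η))
  have key := hmaj K (fun z hz => hsub z hz.2) hKc g
    (fun z hz => ((hgK z (hKne z hz)).1.continuousAt).continuousWithinAt)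
    (fun z hz => hgK z (hKne z (interior_subset hz))) ?_ b ⟨by linarith, hb2⟩
  · have h1 : (M : EReal) ≤ (g b : EReal) := le_trans hbM key
    have h2 : M ≤ g b := by exact_mod_cast h1
    have h3 : Real.log r < Real.log 2 := Real.log_lt_log hr0 (by linarith)
    have h4 : g b = M - η * (Real.log 2 - Real.log r) := by
      simp only [hg, ← dist_eq_norm, ← hr]; ring
    have := mul_pos hη0 (sub_pos.2 h3)
    linarith
  · intro z hz
    have hzK : z ∈ K := hKcl.frontier_subset hz
    have hopen : IsOpen {z : ℂ | r / 2 < dist z 1 ∧ dist z 1 < 2} :=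
      (isOpen_lt continuous_const hd).inter (isOpen_lt hd continuous_const)
    have hni : ¬ (r / 2 < dist z 1 ∧ dist z 1 < 2) := fun hz' =>
      hz.2 (interior_maximal
        (show {z : ℂ | r / 2 < dist z 1 ∧ dist z 1 < 2} ⊆ K from
          fun w hw => ⟨hw.1.le, hw.2.le⟩) hopen hz')
    have hgz : g z = M - η * (Real.log 2 - Real.log (dist z 1)) := by
      simp only [hg, ← dist_eq_norm]; ring
    rw [hgz]
    rcases lt_or_eq_of_le hzK.2 with h2 | h2
    · have h3 : dist z 1 = r / 2 := le_antisymm (not_lt.1 fun h' => hni ⟨h', h2⟩) hzK.1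
      have h4 : η * (Real.log 2 - Real.log (r / 2)) = M - m :=
        div_mul_cancel₀ _ (sub_pos.2 hlog).ne'
      rw [h3, h4, sub_sub_cancel]
      exact (hzmax (Metric.mem_sphere.2 h3)).trans hm1.le
    · rw [h2, sub_self, mul_zero, sub_zero]
      exact hM z (hsub z hzK.2)

variable {V : Type*} [NormedAddCommGroup V] [NormedSpace ℂ V]
  {S : Type*} [TopologicalSpace S] [ChartedSpace V S] [IsManifold 𝓘(ℂ, V) ω S]

/-- In a chart, the complex line through `s₀` and a nearby `s`, with parameters `0` and `1`, reduces
this to the disc of radius `4`; hence the radius `ρ / 4` below. -/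
theorem Plurisubharmonic.eventually_eq_of_isLocalMax {u : S → EReal} (hu : Plurisubharmonic V u)
    {s₀ : S} (hmax : IsLocalMax u s₀) : ∀ᶠ s in 𝓝 s₀, u s = u s₀ := by
  set φ := chartAt V s₀ with hφ
  have hs : s₀ ∈ φ.source := mem_chart_source V s₀
  have hinv : φ.symm (φ s₀) = s₀ := φ.left_inv hs
  have h1 : ∀ᶠ y in 𝓝 (φ s₀), y ∈ φ.target ∧ u (φ.symm y) ≤ u s₀ := by
    have hc : Tendsto φ.symm (𝓝 (φ s₀)) (𝓝 s₀) := by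
      simpa [ContinuousAt, hinv] using φ.continuousAt_symm (φ.map_source hs)
    exact (φ.open_target.eventually_mem (φ.map_source hs)).and (hc.eventually hmax)
  obtain ⟨ρ, hρ, hball⟩ := Metric.eventually_nhds_iff_ball.1 h1
  have h2 := (φ.continuousAt hs).eventually (Metric.ball_mem_nhds (φ s₀) (ε := ρ / 4) (by positivity))
  filter_upwards [h2, φ.open_source.mem_nhds hs] with s h3 h4
  let ℓ : ℂ → V := fun z => φ s₀ + z • (φ s - φ s₀)
  have hℓ : ∀ z ∈ Metric.ball (0 : ℂ) 4, ℓ z ∈ Metric.ball (φ s₀) ρ := by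
    intro z hz
    rw [mem_ball_zero_iff] at hz
    rw [dist_eq_norm] at h3
    rw [Metric.mem_ball, dist_eq_norm]
    simp only [ℓ, add_sub_cancel_left, norm_smul]
    nlinarith [norm_nonneg (φ s - φ s₀), norm_nonneg z]
  have hsm : ContMDiffOn 𝓘(ℂ, ℂ) 𝓘(ℂ, V) ω (fun z => φ.symm (ℓ z)) (Metric.ball 0 4) := by
    have hℓs : ContMDiffOn 𝓘(ℂ, ℂ) 𝓘(ℂ, V) ω ℓ (Metric.ball 0 4) := by
      refine ContDiffOn.contMDiffOn ?_
      simp only [ℓ]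
      fun_prop
    exact ContMDiffOn.comp (g := φ.symm) contMDiffOn_chart_symm hℓs
      fun z hz => (hball _ (hℓ z hz)).1
  have := (hu.2.2 _ _ Metric.isOpen_ball hsm).eq_of_isMax_center (M := u s₀)
    (by simp [ℓ, hinv]) (fun z hz => (hball _ (hℓ z hz)).2)
  simpa [ℓ, φ.left_inv h4] using this

theorem Plurisubharmonic.satisfiesMaximumPrinciple {p : S → ℝ≥0∞}
    (hp : Plurisubharmonic V fun s => ENNReal.log (p s)) : SatisfiesMaximumPrinciple p := by
  intro U hUo hUc hUcl ⟨b, hb⟩ c hc s hs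
  have husc := hp.1
  obtain ⟨s₀, hs₀, hmax⟩ := (husc.upperSemicontinuousOn (closure U)).exists_isMaxOn
    ⟨s, subset_closure hs⟩ hUcl
  by_contra! hlt
  have hM : ENNReal.log c < ENNReal.log (p s₀) :=
    (ENNReal.log_lt_log hlt).trans_le (hmax (subset_closure hs))
  have hs₀U : s₀ ∈ U := by
    by_contra hn
    exact absurd (hc s₀ ⟨hs₀, by rwa [hUo.interior_eq]⟩)
      (not_le.2 (ENNReal.log_lt_log_iff.1 hM))
  set M := ENNReal.log (p s₀) with hMdef
  have hopen : IsOpen {x | x ∈ U ∧ ENNReal.log (p x) = M} := by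
    rw [isOpen_iff_mem_nhds]
    rintro x ⟨hxU, hx⟩
    have hloc : IsLocalMax (fun s => ENNReal.log (p s)) x := by
      filter_upwards [hUo.mem_nhds hxU] with y hy
      rw [hx]
      exact hmax (subset_closure hy)
    filter_upwards [hp.eventually_eq_of_isLocalMax hloc, hUo.mem_nhds hxU] with y h1 h2
    exact ⟨h2, h1.trans hx⟩
  -- The set where the maximum is attained is open by the strong maximum principle, and its
  -- complement in `U` is open by semicontinuity.
  have hall : U ⊆ {x | x ∈ U ∧ ENNReal.log (p x) = M} := by
    refine hUc.isPreconnected.subset_left_of_subset_union hopen (husc.isOpen_preimage M) ?_ ?_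
      ⟨s₀, hs₀U, hs₀U, rfl⟩
    · rw [Set.disjoint_left]
      rintro x ⟨-, hx⟩ hx'
      exact absurd hx' (by simp [hx])
    · intro x hx
      rcases (show ENNReal.log (p x) ≤ M from hmax (subset_closure hx)).lt_or_eq with h1 | h1
      · exact Or.inr h1
      · exact Or.inl ⟨hx, h1⟩
  -- Superlevel sets are closed, so the value `M` on `U` passes to the boundary point `b`.
  have hbM : M ≤ ENNReal.log (p b) := by
    have hsub : U ⊆ (fun s => ENNReal.log (p s)) ⁻¹' Ici M := fun x hx => (hall hx).2.ge
    exact closure_minimal hsub (husc.isClosed_preimage M) hb.1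
  exact absurd (hc b hb) (not_le.2 (ENNReal.log_lt_log_iff.1 (hM.trans_le hbM)))

end MaximumPrinciple

end

theorem theorem1p1
    {V : Type*} [NormedAddCommGroup V] [NormedSpace ℂ V] [FiniteDimensional ℂ V]
    {S : Type*} [TopologicalSpace S] [T2Space S] [ChartedSpace V S] [IsManifold 𝓘(ℂ, V) ω S]
    {F : Type*} [NormedAddCommGroup F] [InnerProductSpace ℂ F] [CompleteSpace F]
    {E : S → Type*} [∀ s, AddCommGroup (E s)] [∀ s, Module ℂ (E s)]
    [∀ s, TopologicalSpace (E s)] [TopologicalSpace (TotalSpace F E)]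
    [FiberBundle F E] [VectorBundle ℂ F E] [ContMDiffVectorBundle ω F E 𝓘(ℂ, V)]
    {F' : Type*} [NormedAddCommGroup F'] [InnerProductSpace ℂ F'] [CompleteSpace F']
    {E' : S → Type*} [∀ s, AddCommGroup (E' s)] [∀ s, Module ℂ (E' s)]
    [∀ s, TopologicalSpace (E' s)] [TopologicalSpace (TotalSpace F' E')]
    [FiberBundle F' E'] [VectorBundle ℂ F' E'] [ContMDiffVectorBundle ω F' E' 𝓘(ℂ, V)]
    (h : HermitianMetric V F E) (h' : HermitianMetric V F' E')
    (A : ∀ s, E s →L[ℂ] E' s)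
    (hA : ContMDiff (𝓘(ℂ, V).prod 𝓘(ℂ, F)) (𝓘(ℂ, V).prod 𝓘(ℂ, F')) ω
      (fun x : TotalSpace F E => (⟨x.1, A x.1 x.2⟩ : TotalSpace F' E')))
    (hcurv : DecreasesCurvature h h' A) :
    Plurisubharmonic V (fun s => ENNReal.log (pointwiseNorm h h' A s)) ∧
      SatisfiesMaximumPrinciple (pointwiseNorm h h' A) := by
  have := plurisubharmonic_log_pointwiseNorm hA hcurv
  exact ⟨this, this.satisfiesMaximumPrinciple⟩
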